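/- **Setting.** Let $\hat\Omega$ be a Hausdorff topological space with Borel $\sigma$-algebra, $\mu$ a $\sigma$-finite Borel measure on $\hat\Omega$ with full support (no nonempty open set is $\mu$-null), and $\Omega\subseteq\hat\Omega$ a measurable set. Let $\Phi:\hat\Omega\times\hat\Omega\times\mathbb R\to[0,\infty]$ be such that $\Phi(\cdot,\cdot,s)$ is measurable, $\Phi(x,y,0)=0$, $\Phi(x,y,\cdot)$ is lower semicontinuous, convex and even, and $\Phi(x,y,\cdot)=\Phi(y,x,\cdot)$. A function $F:A\times\mathbb R\to[0,\infty]$ on a measure space $(A,m)$ satisfies the $\Delta_2$-condition if there are $C>0$ and an $m$-integrable $h:A\to[0,\infty[$ with $F(a,2s)\le C\,F(a,s)+h(a)$ for all $a,s$; its conjugate is $F^*(a,t)=\sup_s (st-F(a,s))$. Assume that $\Phi$ and $\Phi^*$ satisfy the $\Delta_2$-condition with respect to $\mu\otimes\mu$. Put $\mathbf S_\Phi=\{(x,y): \Phi(x,y,\cdot)\not\equiv0\}$ and assume the thickness condition: there are measurable sets $A^{(j)}_n$ ($j\ge0$), $B^{(j)}_n$ ($j\ge1$), $n\in\mathbb N$,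 with $A^{(0)}_n\subseteq\Omega$ such that, with $I^{(j)}=\{n:\mu(A^{(j)}_n)>0\}$, one has $A^{(j)}_n\times B^{(j+1)}_n\subseteq\mathbf S_\Phi$ for $n\in I^{(j)}$, $\bigcup_nA^{(j+1)}_n=\bigcup_{n\in I^{(j)}}B^{(j+1)}_n$, and $\bigcup_j\bigcup_{n\in I^{(j)}}A^{(j)}_n$ has $\mu$-null complement in $\hat\Omega$. Let $W=W^{\Phi,2}(\hat\Omega,\Omega)$ be the space of (classes of) measurable $\hat u:\hat\Omega\to\mathbb R$ with $\hat u|_\Omega\in L^2(\Omega)$ and $\iint\Phi(x,y,(\hat u(x)-\hat u(y))/\lambda)\,d\mu(y)\,d\mu(x)<\infty$ for some $\lambda>0$, with seminorm $\|\hat u\|_W=\|\hat u\|_{L^2(\Omega)}+\inf\{\lambda>0:\iint\Phi(x,y,(\hat u(x)-\hat u(y))/\lambda)\,d\mu\,d\mu\le1\}$; let $j:W\to L^2(\Omega)$ be the restriction and $\mathcal E(\hat u)=\frac12\iint\Phi(x,y,\hat u(x)-\hat u(y))\,d\mu(y)\,d\mu(x)$. Let $\tilde\Omega$ be a compactification of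 $\hat\Omega$ ($\mu$ is extended to $\tilde\Omega$ by zero), and assume that $\mathcal E$ is regular with respect to $\tilde\Omega$: $W\cap C(\tilde\Omega)$ is dense in $W$, and, for the supremum norm, $\overline{\operatorname{span}(W\cap C(\tilde\Omega),1)}=\operatorname{span}(\overline{W\cap C(\tilde\Omega)},1)=C(\tilde\Omega)$. For $A\subseteq\tilde\Omega$ let $\operatorname{Cap}(A)$ be the infimum of $\|\hat w\|_W^2+\mu((A\cap\hat\Omega)\setminus\Omega)$ over all $\hat w\in W$ with $\hat w\ge1$ $\mu$-a.e. on some open $U\supseteq A$. A function $g:\tilde\Omega\to\mathbb R$ is quasi-continuous if for every $\varepsilon>0$ there is an open $U\subseteq\tilde\Omega$ with $\operatorname{Cap}(U)\le\varepsilon$ such that $g$ is continuous on $\tilde\Omega\setminus U$; it is a quasi-continuous representative of $\hat u$ if moreover $g|_{\hat\Omega}=\hat u$ $\mu$-a.e. Let $\nu$ be a Borel measure on $\tilde\Omega$ with $\nu(A)=0$ for all Borel sets $A$ with $\operatorname{Cap}(A)=0$. Let $B:\tilde\Omega\times\mathbb R\to[0,\infty]$ be such that $B(x,0)=0$, $B(x,\cdot)$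 is lower semicontinuous and convex, $B(\cdot,s)$ is measurable, and $B$ and $B^*$ satisfy the $\Delta_2$-condition with respect to $\nu$. In all integrals with respect to $\nu$, functions in $W$ are evaluated through their quasi-continuous representatives. Let $W\cap L^B(\nu)$ be the set of $\hat u\in W$ that have a quasi-continuous representative, which satisfies $\int_{\tilde\Omega}B(x,\hat u(x)/\lambda)\,d\nu(x)<\infty$ for some $\lambda>0$. Let $$\mathcal E_{B,\nu}(\hat u)=\mathcal E(\hat u)+\int_{\tilde\Omega}B(x,\hat u(x))\,d\nu(x)\in[0,\infty]\qquad(\hat u\in W)$$ (with value $\infty$ should $\hat u$ have no quasi-continuous representative). For $u,f\in L^2(\Omega)$, an elliptic extension of $u$ (for $(u,f)$) is a $\hat u\in W$ with $\mathcal E_{B,\nu}(\hat u)<\infty$, $j(\hat u)=u$ and $\mathcal E_{B,\nu}(\hat u+\hat v)-\mathcal E_{B,\nu}(\hat u)\ge\int_\Omega f\hat v\,d\mu$ for all $\hat v\in W$; the $j$-subgradient $\partial_j\mathcal E_{B,\nu}$ is the set of all $(u,f)\in L^2(\Omega)\times L^2(\Omega)$ for which such a $\hat u$ exists. Assume that $\Phi$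 and $B$ are continuously differentiable in the last variable: there are $\varphi:\hat\Omega\times\hat\Omega\times\mathbb R\to\mathbb R$ and $\beta:\tilde\Omega\times\mathbb R\to\mathbb R$, measurable in $(x,y)$ (resp. in $x$) for every fixed value of the last variable, continuous, increasing, odd and vanishing at $0$ in the last variable, $\varphi$ symmetric in $(x,y)$, with $\Phi(x,y,s)=\int_0^s\varphi(x,y,\tau)\,d\tau$ and $B(x,s)=\int_0^s\beta(x,\tau)\,d\tau$. Put $$a(\hat u,\hat v)=\frac12\int_{\hat\Omega}\int_{\hat\Omega}\varphi(x,y,\hat u(x)-\hat u(y))(\hat v(x)-\hat v(y))\,d\mu(y)\,d\mu(x)+\int_{\tilde\Omega}\beta(x,\hat u(x))\hat v(x)\,d\nu(x).$$ Let $\mathcal D\subseteq W\cap L^B(\nu)$ be a linear subspace that separates the points of its associate space $\mathcal D_a=\{g\in L^0(\hat\Omega): g\hat v\in L^1(\hat\Omega)\ \forall\hat v\in\mathcal D\}$, that is, if $g\in\mathcal D_a$ and $\int_{\hat\Omega}g\hat v\,d\mu=0$ for all $\hat v\in\mathcal D$, then $g=0$ $\mu$-a.e. For $g\in\mathcal D_a$,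 we say that $\hat u\in W\cap L^B(\nu)$ is a weak solution of $$\mathcal A\hat u(x):=\mathrm{P.V.}\!\int_{\hat\Omega}\varphi(x,y,\hat u(x)-\hat u(y))\,d\mu(y)+\beta(x,\hat u(x))\tfrac{d\nu}{d\mu}(x)=g(x)$$ (a formal notation), or that $\mathcal A\hat u$ exists in the weak sense and equals $g$, if $a(\hat u,\hat v)=\int_{\hat\Omega}g\hat v\,d\mu$ for all $\hat v\in\mathcal D$. **Theorem.** Let $u,f\in L^2(\Omega)$. 1. One has $(u,f)\in\partial_j\mathcal E_{B,\nu}$ if and only if there is $\hat u\in W\cap L^B(\nu)$ with $\hat u|_\Omega=u$ such that $\hat u$ is a weak solution of $\mathcal A\hat u=f$ in $\Omega$, $\mathcal A\hat u=0$ outside $\Omega$ (one equation, whose right-hand side is $f$ extended by $0$), and such that moreover the Robin identity $$a(\hat u,\hat v)=\int_{\hat\Omega}\mathcal A\hat u(x)\,\hat v(x)\,d\mu(x)\qquad\text{for every }\hat v\in W\cap L^B(\nu)$$ holds, where $\mathcal A\hat u\in\mathcal D_a$ is the value in the weak sense and all $\mathcal A\hat u\,\hat v$ are integrable. 2. The functions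 $\hat u$ as in 1 are exactly the elliptic extensions of $u$ for $(u,f)$. Each of them minimizes both $\mathcal E_{B,\nu}(\hat w)-\int_\Omega f\hat w\,d\mu$ and $\mathcal E_{B,\nu}(\hat w)$ among all $\hat w\in W$ with $j(\hat w)=u$. If $(u,f)\in\partial_j\mathcal E_{B,\nu}$, then conversely every minimizer of $\mathcal E_{B,\nu}$ over $\{\hat w\in W: j(\hat w)=u\}$ is such a $\hat u$. 3. If $\Phi(x,y,\cdot)$ is strictly convex for every $(x,y)\in\mathbf S_\Phi$, then there is at most one elliptic extension of $u$ for $(u,f)$. -/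

import Mathlib

open MeasureTheory Set
open scoped ENNReal

noncomputable section

namespace NonlocalRobin

/-! ### Convexity, conjugates and growth of extended-valued integrands -/

/-- Convexity of a `[0,∞]`-valued function on the real line. -/
def ConvexFn (F : ℝ → ℝ≥0∞) : Prop :=
  ∀ s t a b : ℝ, 0 ≤ a → 0 ≤ b → a + b = 1 →
    F (a * s + b * t) ≤ ENNReal.ofReal a * F s + ENNReal.ofReal b * F t

/-- Strict convexity (on the effective domain) of a `[0,∞]`-valued function on the real line. -/
def StrictConvexFn (F : ℝ → ℝ≥0∞) : Prop :=
  ∀ s t a b : ℝ, s ≠ t → F s ≠ ⊤ → F t ≠ ⊤ → 0 < a → 0 < b → a + b = 1 →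
    F (a * s + b * t) < ENNReal.ofReal a * F s + ENNReal.ofReal b * F t

/-- The Fenchel conjugate `t ↦ sup_s (s t - F a s)` in the last variable. For `F a 0 = 0` this
supremum is nonnegative, so that it may be computed with the positive parts of `s t - F a s`,
that is, with the subtraction of `[0,∞]`. -/
def conj {α : Type*} (F : α → ℝ → ℝ≥0∞) (a : α) (t : ℝ) : ℝ≥0∞ :=
  ⨆ s : ℝ, ENNReal.ofReal (s * t) - F a s

/-- The `Δ₂`-condition with respect to a measure `m`. -/
def Delta2 {α : Type*} [MeasurableSpace α] (m : Measure α) (F : α → ℝ → ℝ≥0∞) : Prop :=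
  ∃ C : ℝ, 0 < C ∧ ∃ h : α → ℝ, Integrable h m ∧ (∀ a, 0 ≤ h a) ∧
    ∀ a s, F a (2 * s) ≤ ENNReal.ofReal C * F a s + ENNReal.ofReal (h a)

/-! ### Standard conditions on the kernel -/

section Kernel

variable {X : Type*} [MeasurableSpace X]

/-- The measurability and convexity condition on `Φ`. -/
structure KernelCond (Φ : X → X → ℝ → ℝ≥0∞) : Prop where
  measurable : ∀ s, Measurable fun p : X × X => Φ p.1 p.2 s
  zero : ∀ x y, Φ x y 0 = 0
  lsc : ∀ x y, LowerSemicontinuous (Φ x y)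
  convex : ∀ x y, ConvexFn (Φ x y)
  even : ∀ x y s, Φ x y (-s) = Φ x y s
  symm : ∀ x y s, Φ x y s = Φ y x s

/-- The set `S_Φ` of all pairs `(x,y)` for which `Φ(x,y,·)` does not vanish identically. -/
def supp (Φ : X → X → ℝ → ℝ≥0∞) : Set (X × X) := {p | ∃ s, Φ p.1 p.2 s ≠ 0}

/-- The thickness condition on a set `S` of pairs: starting with countably many measurable subsets
of `Ω`, one can exhaust the whole space up to a null set by passing repeatedly from sets `A j n`
of positive measure to sets `B (j + 1) n` with `A j n × B (j + 1) n ⊆ S`, where at each stage the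
union of the sets obtained may be rearranged into another sequence of measurable sets. -/
def Thick (μ : Measure X) (Ω : Set X) (S : Set (X × X)) : Prop :=
  ∃ A B : ℕ → ℕ → Set X,
    (∀ j n, MeasurableSet (A j n)) ∧ (∀ j n, MeasurableSet (B j n)) ∧
    (∀ n, A 0 n ⊆ Ω) ∧
    (∀ j n, 0 < μ (A j n) → A j n ×ˢ B (j + 1) n ⊆ S) ∧
    (∀ j, ⋃ n, A (j + 1) n = ⋃ n ∈ {n | 0 < μ (A j n)}, B (j + 1) n) ∧
    μ (⋃ j, ⋃ n ∈ {n | 0 < μ (A j n)}, A j n)ᶜ = 0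

/-- The standard conditions on `Φ`. -/
structure StandardCond (μ : Measure X) (Ω : Set X) (Φ : X → X → ℝ → ℝ≥0∞) : Prop where
  kernel : KernelCond Φ
  delta2 : Delta2 (μ.prod μ) fun p => Φ p.1 p.2
  delta2_conj : Delta2 (μ.prod μ) (conj fun p : X × X => Φ p.1 p.2)
  thick : Thick μ Ω (supp Φ)

/-- `Φ` is continuously differentiable in the last variable, with derivative `φ`. -/
structure KernelDeriv (Φ : X → X → ℝ → ℝ≥0∞) (φ : X → X → ℝ → ℝ) : Prop where
  measurable : ∀ s, Measurable fun p : X × X => φ p.1 p.2 s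
  symm : ∀ x y s, φ x y s = φ y x s
  zero : ∀ x y, φ x y 0 = 0
  continuous : ∀ x y, Continuous (φ x y)
  monotone : ∀ x y, Monotone (φ x y)
  odd : ∀ x y s, φ x y (-s) = -φ x y s
  integral : ∀ x y s, Φ x y s = ENNReal.ofReal (∫ τ in (0 : ℝ)..s, φ x y τ)

/-! ### The Musielak-Orlicz-Sobolev type space, its seminorm and its energy -/

variable (μ : Measure X) (Ω : Set X) (Φ : X → X → ℝ → ℝ≥0∞)

/-- The modular `∫∫ Φ(x,y,(û(x)-û(y))/l) dμ(y) dμ(x)`. -/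
def modular (l : ℝ) (u : X →ₘ[μ] ℝ) : ℝ≥0∞ :=
  ∫⁻ p : X × X, Φ p.1 p.2 ((u p.1 - u p.2) / l) ∂(μ.prod μ)

/-- The space `W^{Φ,2}(Ω̂,Ω)`. -/
def W : Set (X →ₘ[μ] ℝ) :=
  {u | (∃ l : ℝ, 0 < l ∧ modular μ Φ l u < ⊤) ∧ MemLp u 2 (μ.restrict Ω)}

/-- The seminorm of `W^{Φ,2}(Ω̂,Ω)`: the `L²(Ω)`-norm plus the Minkowski functional of the
modular. -/
def normW (u : X →ₘ[μ] ℝ) : ℝ≥0∞ :=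
  eLpNorm u 2 (μ.restrict Ω) +
    ⨅ (l : ℝ) (_ : 0 < l ∧ modular μ Φ l u ≤ 1), ENNReal.ofReal l

/-- The energy `½ ∫∫ Φ(x,y,û(x)-û(y)) dμ(y) dμ(x)`. -/
def energy (u : X →ₘ[μ] ℝ) : ℝ≥0∞ :=
  2⁻¹ * ∫⁻ p : X × X, Φ p.1 p.2 (u p.1 - u p.2) ∂(μ.prod μ)

open Classical in
/-- The restriction operator `û ↦ û|_Ω` into `L²(Ω)` (used only where `û|_Ω` is in `L²`). -/
def restr (u : X →ₘ[μ] ℝ) : Lp ℝ 2 (μ.restrict Ω) :=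
  if h : MemLp u 2 (μ.restrict Ω) then h.toLp u else 0

end Kernel

/-! ### `j`-subgradients -/

section Subgradient

variable {V H : Type*} [AddCommGroup V] [NormedAddCommGroup H] [InnerProductSpace ℝ H]

/-- `û` is an elliptic extension of `u` for `(u,f)`: it belongs to the effective domain of the
energy `E : W → [0,∞]`, it satisfies `j(û) = u`, and `E(û+v̂) - E(û) ≥ ⟨f, j(v̂)⟩` for all
`v̂ ∈ W`. Here `W` is a linear subspace of `V`. -/
def IsEllipticExtension (W : Set V) (j : V → H) (E : V → ℝ≥0∞) (u f : H) (w : V) : Prop :=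
  w ∈ W ∧ E w < ⊤ ∧ j w = u ∧
    ∀ v ∈ W, ((inner ℝ f (j v) : ℝ) : EReal) ≤ (E (w + v) : EReal) - (E w : EReal)

/-- The `j`-subgradient of `E : W → [0,∞]`. -/
def jSubgradient (W : Set V) (j : V → H) (E : V → ℝ≥0∞) : Set (H × H) :=
  {p | ∃ w, IsEllipticExtension W j E p.1 p.2 w}

/-- The set of minimizers of `F` over the set `s`. -/
def argmin (F : V → EReal) (s : Set V) : Set V := {w | w ∈ s ∧ IsMinOn F s w}

end Subgradient

/-! ### Capacity, quasi-continuity and regularity on a compactification -/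

section Capacity

variable {X K : Type*} [MeasurableSpace X] [TopologicalSpace K]
variable (μ : Measure X) (Ω : Set X) (Φ : X → X → ℝ → ℝ≥0∞) (ι : X → K)

/-- The capacity of a subset of the compactification. The measure `μ` is extended by zero to the
compactification. -/
def cap (A : Set K) : ℝ≥0∞ :=
  ⨅ (w : X →ₘ[μ] ℝ)
    (_ : w ∈ W μ Ω Φ ∧ ∃ U : Set K, IsOpen U ∧ A ⊆ U ∧ ∀ᵐ x ∂μ, ι x ∈ U → 1 ≤ w x),
    normW μ Ω Φ w ^ 2 + μ (ι ⁻¹' A \ Ω)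

/-- Quasi-continuity of a function on the compactification. -/
def QuasiContinuous (g : K → ℝ) : Prop :=
  ∀ ε : ℝ≥0∞, 0 < ε → ∃ U : Set K, IsOpen U ∧ cap μ Ω Φ ι U ≤ ε ∧ ContinuousOn g Uᶜ

/-- `g` is a quasi-continuous representative of `û`, defined on the whole compactification. -/
def IsQCRep (u : X →ₘ[μ] ℝ) (g : K → ℝ) : Prop :=
  QuasiContinuous μ Ω Φ ι g ∧ ∀ᵐ x ∂μ, g (ι x) = u x

/-- A quasi-continuous representative of `û` (if there is one). -/
def qcRep (u : X →ₘ[μ] ℝ) : K → ℝ := Classical.epsilon (IsQCRep μ Ω Φ ι u)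

/-- `W^{Φ,2}(Ω̂,Ω) ∩ C(Ω̃)`, as a set of continuous functions on the compactification. -/
def core : Set C(K, ℝ) := {g | ∃ w ∈ W μ Ω Φ, ∀ᵐ x ∂μ, w x = g (ι x)}

/-- The energy is regular with respect to the compactification: `C(Ω̃)` is a regular core. -/
structure IsRegularEnergy : Prop where
  dense : ∀ u ∈ W μ Ω Φ, ∀ ε : ℝ≥0∞, 0 < ε →
    ∃ w ∈ W μ Ω Φ, (∃ g : C(K, ℝ), ∀ᵐ x ∂μ, w x = g (ι x)) ∧ normW μ Ω Φ (u - w) < ε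
  closure_span : closure (Submodule.span ℝ (core μ Ω Φ ι ∪ {1}) : Set C(K, ℝ)) = univ
  span_closure : (Submodule.span ℝ (closure (core μ Ω Φ ι) ∪ {1}) : Set C(K, ℝ)) = univ

/-- Absolute continuity of a Borel measure with respect to the capacity. -/
def CapAbsCont [MeasurableSpace K] (ν : Measure K) : Prop :=
  ∀ A : Set K, MeasurableSet A → cap μ Ω Φ ι A = 0 → ν A = 0

end Capacity

/-! ### Potentials and the perturbed energy -/

section Potential

variable {X K : Type*} [MeasurableSpace X] [TopologicalSpace K] [MeasurableSpace K]

/-- The conditions on the potential `B`. -/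
structure PotentialCond (B : K → ℝ → ℝ≥0∞) : Prop where
  zero : ∀ x, B x 0 = 0
  lsc : ∀ x, LowerSemicontinuous (B x)
  convex : ∀ x, ConvexFn (B x)
  measurable : ∀ s, Measurable fun x => B x s

/-- `B` is continuously differentiable in the last variable, with derivative `β`. -/
structure PotentialDeriv (B : K → ℝ → ℝ≥0∞) (β : K → ℝ → ℝ) : Prop where
  measurable : ∀ s, Measurable fun x => β x s
  zero : ∀ x, β x 0 = 0
  continuous : ∀ x, Continuous (β x)
  monotone : ∀ x, Monotone (β x)
  odd : ∀ x s, β x (-s) = -β x s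
  integral : ∀ x s, B x s = ENNReal.ofReal (∫ τ in (0 : ℝ)..s, β x τ)

/-- Membership in the Musielak-Orlicz space `L^B(Ω̃,ν)`. -/
def MemLB (ν : Measure K) (B : K → ℝ → ℝ≥0∞) (g : K → ℝ) : Prop :=
  AEMeasurable g ν ∧ ∃ l : ℝ, 0 < l ∧ ∫⁻ x, B x (g x / l) ∂ν < ⊤

variable (μ : Measure X) (Ω : Set X) (Φ : X → X → ℝ → ℝ≥0∞) (ι : X → K)
variable (B : K → ℝ → ℝ≥0∞) (ν : Measure K)

/-- The space `W^{Φ,2}(Ω̂,Ω) ∩ L^B(Ω̃,ν)`: the elements of `W^{Φ,2}(Ω̂,Ω)` whose quasi-continuous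
representative belongs to `L^B(Ω̃,ν)`. -/
def WB : Set (X →ₘ[μ] ℝ) :=
  {u | u ∈ W μ Ω Φ ∧ (∃ g, IsQCRep μ Ω Φ ι u g) ∧ MemLB ν B (qcRep μ Ω Φ ι u)}

open Classical in
/-- The perturbed energy `E(û) + ∫ B(x,û(x)) dν(x)`, where the last integral is taken with a
quasi-continuous representative of `û` (and is `∞` should there be none). -/
def energyB (u : X →ₘ[μ] ℝ) : ℝ≥0∞ :=
  energy μ Φ u +
    if ∃ g, IsQCRep μ Ω Φ ι u g then ∫⁻ x, B x (qcRep μ Ω Φ ι u x) ∂ν else ⊤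

end Potential

/-! ### Test functions, weak solutions and the Robin identity -/

section Weak

variable {X K : Type*} [MeasurableSpace X] [TopologicalSpace K] [MeasurableSpace K]
variable {μ : Measure X}

/-- The associate space `D_a` of a space `D` of test functions. -/
def associate (D : Submodule ℝ (X →ₘ[μ] ℝ)) : Set (X → ℝ) :=
  {g | AEStronglyMeasurable g μ ∧ ∀ v ∈ D, Integrable (fun x => g x * v x) μ}

/-- `D` separates the points of its associate space. -/
def SeparatesAssociate (D : Submodule ℝ (X →ₘ[μ] ℝ)) : Prop :=
  ∀ g ∈ associate D, (∀ v ∈ D, ∫ x, g x * v x ∂μ = 0) → g =ᵐ[μ] 0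

variable (Ω : Set X) (Φ : X → X → ℝ → ℝ≥0∞) (ι : X → K)
variable (φ : X → X → ℝ → ℝ) (B : K → ℝ → ℝ≥0∞) (β : K → ℝ → ℝ) (ν : Measure K)

/-- The form
`½ ∫∫ φ(x,y,û(x)-û(y)) (v̂(x)-v̂(y)) dμ(y) dμ(x) + ∫ β(x,û(x)) v̂(x) dν(x)`,
where the last integral is taken with quasi-continuous representatives. -/
def form (u v : X →ₘ[μ] ℝ) : ℝ :=
  1 / 2 * ∫ p : X × X, φ p.1 p.2 (u p.1 - u p.2) * (v p.1 - v p.2) ∂(μ.prod μ) +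
    ∫ x, β x (qcRep μ Ω Φ ι u x) * qcRep μ Ω Φ ι v x ∂ν

/-- `û` is a weak solution, with respect to the test functions in `D`, of
`P.V.∫ φ(x,y,û(x)-û(y)) dμ(y) + β(x,û(x)) dν/dμ(x) = g(x)`; in other words, the operator on the
left-hand side, applied to `û`, exists in the weak sense and equals `g ∈ D_a`. -/
def IsWeakSolution (D : Submodule ℝ (X →ₘ[μ] ℝ)) (u : X →ₘ[μ] ℝ) (g : X → ℝ) : Prop :=
  u ∈ WB μ Ω Φ ι B ν ∧ g ∈ associate D ∧
    ∀ v ∈ D, form Ω Φ ι φ β ν u v = ∫ x, g x * v x ∂μ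

/-- The Robin identity: the operator `P.V.∫ φ(x,y,û(x)-û(y)) dμ(y) + β(x,û(x)) dν/dμ(x)` exists in
the weak sense (it is a function `g ∈ D_a`, determined by the test functions in `D`), and the
integration by parts formula with this function `g` extends from `D` to all functions in
`W^{Φ,2}(Ω̂,Ω) ∩ L^B(Ω̃,ν)`. -/
def RobinIdentity (D : Submodule ℝ (X →ₘ[μ] ℝ)) (u : X →ₘ[μ] ℝ) : Prop :=
  ∃ g : X → ℝ, IsWeakSolution Ω Φ ι φ B β ν D u g ∧
    ∀ v ∈ WB μ Ω Φ ι B ν, Integrable (fun x => g x * v x) μ ∧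
      form Ω Φ ι φ β ν u v = ∫ x, g x * v x ∂μ

/-- `û` extends `u`, it is a weak solution of the nonlocal equation with right-hand side `f` in `Ω`
and `0` outside `Ω`, and it satisfies the Robin identity. -/
def IsRobinSolution (D : Submodule ℝ (X →ₘ[μ] ℝ)) (u f : Lp ℝ 2 (μ.restrict Ω))
    (w : X →ₘ[μ] ℝ) : Prop :=
  w ∈ WB μ Ω Φ ι B ν ∧ restr μ Ω w = u ∧
    IsWeakSolution Ω Φ ι φ B β ν D w (Ω.indicator f) ∧ RobinIdentity Ω Φ ι φ B β ν D w

end Weak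

end NonlocalRobin

end

/-!
The energy `E_{B,ν}` is convex and Gateaux differentiable on its effective domain `W ∩ L^B(ν)`,
with derivative `form ŵ ·`. Hence `ŵ` is an elliptic extension for `(u,f)` if and only if it lies
in this domain, restricts to `u` and satisfies `form ŵ v̂ = ⟨f, j v̂⟩` for all `v̂ ∈ W ∩ L^B(ν)`
(`EnergyData.isEllipticExtension_iff`). This is the Robin identity for the function `f`, extended
by zero; conversely, the value of the operator in any Robin identity has to be this function,
because the test functions separate the points of their associate space
(`EnergyData.isRobinSolution_iff`).

The two parts of the energy are treated alike, as modulars `∫ F(a, g(a)) dm(a)` of a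
`SmoothIntegrand` with derivative `b`. By monotonicity, `|b(s) t| ≤ F(2 s) + F(2 t)`, so that the
`Δ₂`-condition makes the functions of finite modular a vector space on which the first variation
is defined (`FinMod.integrable_mul`). One half of the differentiability is the subgradient
inequality; the other half follows by applying it at `ŵ + t v̂` in the direction `-t v̂` and passing
to the limit, by dominated convergence (`EnergyData.form_eq_of_support`).

The integrals with respect to `ν` involve chosen quasi-continuous representatives. These depend
linearly on the function up to `ν`-null sets, because the capacity is quasi-subadditive
(`cap_union_le`) and a quasi-continuous function that vanishes `μ`-a.e. vanishes outside sets of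
capacity zero (`QuasiContinuous.ae_eq_zero`).

If `j(v̂) = u`, then the subgradient inequality at an elliptic extension `ŵ` in the direction
`v̂ - ŵ`, on which `⟨f, j ·⟩` vanishes, shows that `ŵ` has least energy; this gives the statements
on minimizers. For uniqueness, strict convexity forces two minimizers to have the same increments
almost everywhere on `S_Φ`; their difference vanishes on `Ω`, and this property spreads along the
sets of the thickness condition (`Thick.ae_eq_zero`).
-/

namespace NonlocalRobin

open Filter Topology

/-! ### Convex integrands and their modulars -/

section Integrand

variable {α : Type*} [MeasurableSpace α]

/-- A finite convex Carathéodory integrand `F` on `α × ℝ`, vanishing at `0`, with an odd continuous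
derivative `b` in the last variable. Both `(Φ, φ)` on pairs of points and `(B, β)` on the
compactification are of this form. -/
structure SmoothIntegrand (F : α → ℝ → ℝ≥0∞) (b : α → ℝ → ℝ) : Prop where
  measurable_left : ∀ s, Measurable fun a => F a s
  measurable : ∀ s, Measurable fun a => b a s
  zero : ∀ a, b a 0 = 0
  continuous : ∀ a, Continuous (b a)
  monotone : ∀ a, Monotone (b a)
  odd : ∀ a s, b a (-s) = -b a s
  integral : ∀ a s, F a s = ENNReal.ofReal (∫ τ in (0 : ℝ)..s, b a τ)
  convex : ∀ a, ConvexFn (F a)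

variable {F : α → ℝ → ℝ≥0∞} {b : α → ℝ → ℝ} {m : Measure α}

namespace SmoothIntegrand

lemma mul_sub_le_integral (h : SmoothIntegrand F b) (a : α) (s t : ℝ) :
    b a s * (t - s) ≤ ∫ τ in s..t, b a τ := by
  have hi : ∀ c d, IntervalIntegrable (b a) volume c d :=
    fun c d => (h.continuous a).intervalIntegrable c d
  have hc : ∀ c d, IntervalIntegrable (fun _ : ℝ => b a s) volume c d :=
    fun c d => continuous_const.intervalIntegrable c d
  rcases le_total s t with hst | hst
  · have := intervalIntegral.integral_mono_on hst (hc s t) (hi s t)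
      fun x hx => h.monotone a hx.1
    simpa [mul_comm] using this
  · have := intervalIntegral.integral_mono_on hst (hi t s) (hc t s)
      fun x hx => h.monotone a hx.2
    rw [intervalIntegral.integral_symm]
    simp only [intervalIntegral.integral_const, smul_eq_mul] at this
    linarith

lemma integral_nonneg (h : SmoothIntegrand F b) (a : α) (s : ℝ) :
    0 ≤ ∫ τ in (0 : ℝ)..s, b a τ := by
  simpa [h.zero] using h.mul_sub_le_integral a 0 s

lemma ne_top (h : SmoothIntegrand F b) (a : α) (s : ℝ) : F a s ≠ ⊤ := by
  rw [h.integral]; exact ENNReal.ofReal_ne_top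

lemma toReal_eq (h : SmoothIntegrand F b) (a : α) (s : ℝ) :
    (F a s).toReal = ∫ τ in (0 : ℝ)..s, b a τ := by
  rw [h.integral, ENNReal.toReal_ofReal (h.integral_nonneg a s)]

/-- The subgradient inequality for `F a` at `s`. -/
lemma toReal_add_mul_le (h : SmoothIntegrand F b) (a : α) (s t : ℝ) :
    (F a s).toReal + b a s * (t - s) ≤ (F a t).toReal := by
  have h1 := h.mul_sub_le_integral a s t
  have h2 := intervalIntegral.integral_add_adjacent_intervals
    ((h.continuous a).intervalIntegrable (μ := volume) 0 s)
    ((h.continuous a).intervalIntegrable s t)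
  rw [h.toReal_eq, h.toReal_eq]
  linarith

lemma apply_zero (h : SmoothIntegrand F b) (a : α) : F a 0 = 0 := by
  simp [h.integral]

lemma even (h : SmoothIntegrand F b) (a : α) (s : ℝ) : F a (-s) = F a s := by
  rw [h.integral, h.integral]
  congr 1
  have := intervalIntegral.integral_comp_neg (a := 0) (b := s) (fun τ => b a τ)
  simp only [h.odd, neg_zero, intervalIntegral.integral_neg] at this
  rw [intervalIntegral.integral_symm, ← this, neg_neg]

lemma apply_abs (h : SmoothIntegrand F b) (a : α) (s : ℝ) : F a |s| = F a s := by
  rcases abs_choice s with hs | hs <;> rw [hs]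
  exact h.even a s

lemma abs_apply (h : SmoothIntegrand F b) (a : α) (s : ℝ) : |b a s| = b a |s| := by
  rcases le_total 0 s with hs | hs
  · rw [abs_of_nonneg hs, abs_of_nonneg]
    simpa [h.zero] using h.monotone a hs
  · rw [abs_of_nonpos hs, abs_of_nonpos, h.odd]
    simpa [h.zero] using h.monotone a hs

lemma mono_abs (h : SmoothIntegrand F b) (a : α) {s t : ℝ} (hst : |s| ≤ |t|) :
    F a s ≤ F a t := by
  rw [← h.apply_abs a s, ← h.apply_abs a t]
  rw [← ENNReal.toReal_le_toReal (h.ne_top _ _) (h.ne_top _ _)]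
  have h1 := h.toReal_add_mul_le a |s| |t|
  have h2 : 0 ≤ b a |s| := by rw [← h.abs_apply]; exact abs_nonneg _
  nlinarith [mul_nonneg h2 (sub_nonneg.2 hst)]

lemma apply_half_add_le (h : SmoothIntegrand F b) (a : α) (s t : ℝ) :
    F a (2⁻¹ * s + 2⁻¹ * t) ≤ 2⁻¹ * F a s + 2⁻¹ * F a t := by
  have := h.convex a s t 2⁻¹ 2⁻¹ (by norm_num) (by norm_num) (by norm_num)
  rwa [ENNReal.ofReal_inv_of_pos two_pos, ENNReal.ofReal_ofNat] at this

lemma toReal_half_add_le (h : SmoothIntegrand F b) (a : α) (s t : ℝ) :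
    (F a (2⁻¹ * s + 2⁻¹ * t)).toReal ≤ 2⁻¹ * (F a s).toReal + 2⁻¹ * (F a t).toReal := by
  have hs : 2⁻¹ * F a s ≠ ⊤ := ENNReal.mul_ne_top (by simp) (h.ne_top a s)
  have ht : 2⁻¹ * F a t ≠ ⊤ := ENNReal.mul_ne_top (by simp) (h.ne_top a t)
  have h1 := ENNReal.toReal_mono (ENNReal.add_ne_top.2 ⟨hs, ht⟩) (h.apply_half_add_le a s t)
  rw [ENNReal.toReal_add hs ht, ENNReal.toReal_mul, ENNReal.toReal_mul] at h1
  simpa using h1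

lemma apply_add_le (h : SmoothIntegrand F b) (a : α) (s t : ℝ) :
    F a (s + t) ≤ F a (2 * s) + F a (2 * t) := by
  have h1 := h.apply_half_add_le a (2 * s) (2 * t)
  have h2 : (2 : ℝ≥0∞)⁻¹ ≤ 1 := by simp
  calc F a (s + t) = F a (2⁻¹ * (2 * s) + 2⁻¹ * (2 * t)) := by congr 1; ring
    _ ≤ _ := h1
    _ ≤ 1 * F a (2 * s) + 1 * F a (2 * t) := by gcongr
    _ = _ := by simp

/-- A form of Young's inequality that does not involve the conjugate of `F`: the left-hand side is
at most `b a r * r` for the larger `r` of `|s|` and `|t|`, and this is at most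
`F a (2 * r) - F a r`. -/
lemma abs_mul_le (h : SmoothIntegrand F b) (a : α) (s t : ℝ) :
    |b a s * t| ≤ (F a (2 * s)).toReal + (F a (2 * t)).toReal := by
  have key : ∀ r : ℝ, b a |r| * |r| ≤ (F a (2 * r)).toReal := fun r => by
    have h1 := h.toReal_add_mul_le a |r| (2 * |r|)
    have h2 : (F a (2 * |r|)).toReal = (F a (2 * r)).toReal := by
      rw [← h.apply_abs a (2 * r), abs_mul, abs_two]
    have : 0 ≤ (F a |r|).toReal := ENNReal.toReal_nonneg
    rw [← h2]
    linarith
  rw [abs_mul, h.abs_apply]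
  have h0 : ∀ r : ℝ, 0 ≤ b a |r| := fun r => by rw [← h.abs_apply]; exact abs_nonneg _
  have n1 : 0 ≤ (F a (2 * s)).toReal := ENNReal.toReal_nonneg
  have n2 : 0 ≤ (F a (2 * t)).toReal := ENNReal.toReal_nonneg
  rcases le_total |s| |t| with hst | hst
  · have := mul_le_mul_of_nonneg_right (h.monotone a hst) (abs_nonneg t)
    linarith [key t]
  · have := mul_le_mul_of_nonneg_left hst (h0 s)
    linarith [key s]

lemma continuous_left (h : SmoothIntegrand F b) (a : α) : Continuous (F a) := by
  have : F a = fun s => ENNReal.ofReal (∫ τ in (0 : ℝ)..s, b a τ) := funext (h.integral a)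
  rw [this]
  exact ENNReal.continuous_ofReal.comp
    (intervalIntegral.continuous_primitive (fun c d => (h.continuous a).intervalIntegrable c d) 0)

lemma aemeasurable_left (h : SmoothIntegrand F b) {g : α → ℝ} (hg : AEMeasurable g m) :
    AEMeasurable (fun a => F a (g a)) m := by
  have := measurable_uncurry_of_continuous_of_measurable (u := fun s a => F a s)
    h.continuous_left h.measurable_left
  exact this.comp_aemeasurable (hg.prodMk aemeasurable_id)

lemma aemeasurable (h : SmoothIntegrand F b) {g : α → ℝ} (hg : AEMeasurable g m) :
    AEMeasurable (fun a => b a (g a)) m := by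
  have := measurable_uncurry_of_continuous_of_measurable (u := fun s a => b a s)
    h.continuous h.measurable
  exact this.comp_aemeasurable (hg.prodMk aemeasurable_id)

end SmoothIntegrand

/-- Almost everywhere measurable functions with finite modular. Under the `Δ₂`-condition they
form the Musielak-Orlicz space of `F`. -/
def FinMod (m : Measure α) (F : α → ℝ → ℝ≥0∞) (g : α → ℝ) : Prop :=
  AEMeasurable g m ∧ ∫⁻ a, F a (g a) ∂m < ⊤

namespace FinMod

variable {g k : α → ℝ}

lemma congr (hg : FinMod m F g) (hgk : g =ᵐ[m] k) : FinMod m F k := by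
  refine ⟨hg.1.congr hgk, ?_⟩
  have h1 : (fun a => F a (g a)) =ᵐ[m] fun a => F a (k a) :=
    hgk.mono fun a ha => by simp only [ha]
  rw [← lintegral_congr_ae h1]
  exact hg.2

lemma mono (hg : FinMod m F g) (h : SmoothIntegrand F b) (hk : AEMeasurable k m)
    (hkg : ∀ a, |k a| ≤ |g a|) : FinMod m F k :=
  ⟨hk, (lintegral_mono fun a => h.mono_abs a (hkg a)).trans_lt hg.2⟩

lemma two_mul (hg : FinMod m F g) (h : SmoothIntegrand F b) (hΔ : Delta2 m F) :
    FinMod m F fun a => 2 * g a := by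
  obtain ⟨C, -, r, hr, -, hC⟩ := hΔ
  refine ⟨hg.1.const_mul 2, (lintegral_mono fun a => hC a (g a)).trans_lt ?_⟩
  rw [lintegral_add_left' ((h.aemeasurable_left hg.1).const_mul _),
    lintegral_const_mul' _ _ ENNReal.ofReal_ne_top]
  refine ENNReal.add_lt_top.2 ⟨ENNReal.mul_lt_top ENNReal.ofReal_lt_top hg.2, ?_⟩
  exact hr.lintegral_lt_top

lemma const_mul (hg : FinMod m F g) (h : SmoothIntegrand F b) (hΔ : Delta2 m F) (c : ℝ) :
    FinMod m F fun a => c * g a := by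
  have hpow : ∀ n : ℕ, FinMod m F fun a => 2 ^ n * g a := fun n => by
    induction n with
    | zero => simpa using hg
    | succ n ih => exact (ih.two_mul h hΔ).congr (.of_forall fun a => by dsimp only; ring)
  obtain ⟨n, hn⟩ := pow_unbounded_of_one_lt |c| one_lt_two
  refine (hpow n).mono h (hg.1.const_mul c) fun a => ?_
  rw [abs_mul, abs_mul, abs_of_pos (a := (2 : ℝ) ^ n) (by positivity)]
  gcongr

lemma add (hg : FinMod m F g) (hk : FinMod m F k) (h : SmoothIntegrand F b)
    (hΔ : Delta2 m F) : FinMod m F fun a => g a + k a := by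
  have hg2 := hg.two_mul h hΔ
  have hk2 := hk.two_mul h hΔ
  refine ⟨hg.1.add hk.1, (lintegral_mono fun a => h.apply_add_le a (g a) (k a)).trans_lt ?_⟩
  rw [lintegral_add_left' (h.aemeasurable_left hg2.1)]
  exact ENNReal.add_lt_top.2 ⟨hg2.2, hk2.2⟩

lemma iff_exists (h : SmoothIntegrand F b) (hΔ : Delta2 m F) :
    FinMod m F g ↔ AEMeasurable g m ∧ ∃ l : ℝ, 0 < l ∧ ∫⁻ a, F a (g a / l) ∂m < ⊤ := by
  refine ⟨fun hg => ⟨hg.1, 1, one_pos, by simpa using hg.2⟩, ?_⟩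
  rintro ⟨hg, l, hl, hf⟩
  have h1 : FinMod m F fun a => g a / l := ⟨hg.div_const l, hf⟩
  have h2 := h1.const_mul h hΔ l
  have : (fun a => l * (g a / l)) = g := by
    funext a
    field_simp
  rwa [this] at h2

lemma integrable_toReal (hg : FinMod m F g) (h : SmoothIntegrand F b) :
    Integrable (fun a => (F a (g a)).toReal) m :=
  integrable_toReal_of_lintegral_ne_top (h.aemeasurable_left hg.1) hg.2.ne

lemma toReal_lintegral (hg : FinMod m F g) (h : SmoothIntegrand F b) :
    (∫⁻ a, F a (g a) ∂m).toReal = ∫ a, (F a (g a)).toReal ∂m :=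
  (integral_toReal (h.aemeasurable_left hg.1)
    (Eventually.of_forall fun a => (h.ne_top a _).lt_top)).symm

lemma integrable_mul (hg : FinMod m F g) (hk : FinMod m F k) (h : SmoothIntegrand F b)
    (hΔ : Delta2 m F) : Integrable (fun a => b a (g a) * k a) m := by
  refine ((hg.two_mul h hΔ).integrable_toReal h |>.add
    ((hk.two_mul h hΔ).integrable_toReal h)).mono'
    ((h.aemeasurable hg.1).mul hk.1).aestronglyMeasurable (Eventually.of_forall fun a => ?_)
  exact h.abs_mul_le a (g a) (k a)

/-- The integrated subgradient inequality. -/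
lemma toReal_lintegral_add_le (hg : FinMod m F g) (hk : FinMod m F k) (h : SmoothIntegrand F b)
    (hΔ : Delta2 m F) :
    (∫⁻ a, F a (g a) ∂m).toReal + ∫ a, b a (g a) * k a ∂m ≤
      (∫⁻ a, F a (g a + k a) ∂m).toReal := by
  rw [hg.toReal_lintegral h, (hg.add hk h hΔ).toReal_lintegral h,
    ← integral_add (hg.integrable_toReal h) (hg.integrable_mul hk h hΔ)]
  refine integral_mono ((hg.integrable_toReal h).add (hg.integrable_mul hk h hΔ))
    ((hg.add hk h hΔ).integrable_toReal h) fun a => ?_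
  simpa using h.toReal_add_mul_le a (g a) (g a + k a)

lemma half_add (hg : FinMod m F g) (hk : FinMod m F k) (h : SmoothIntegrand F b)
    (hΔ : Delta2 m F) : FinMod m F fun a => 2⁻¹ * g a + 2⁻¹ * k a :=
  (hg.const_mul h hΔ _).add (hk.const_mul h hΔ _) h hΔ

/-- The defect of midpoint convexity of the modular, as the integral of a nonnegative function. -/
lemma integral_half_add_defect (hg : FinMod m F g) (hk : FinMod m F k)
    (h : SmoothIntegrand F b) (hΔ : Delta2 m F) :
    Integrable (fun a => 2⁻¹ * (F a (g a)).toReal + 2⁻¹ * (F a (k a)).toReal -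
      (F a (2⁻¹ * g a + 2⁻¹ * k a)).toReal) m ∧
    ∫ a, (2⁻¹ * (F a (g a)).toReal + 2⁻¹ * (F a (k a)).toReal -
      (F a (2⁻¹ * g a + 2⁻¹ * k a)).toReal) ∂m =
    2⁻¹ * (∫⁻ a, F a (g a) ∂m).toReal + 2⁻¹ * (∫⁻ a, F a (k a) ∂m).toReal -
      (∫⁻ a, F a (2⁻¹ * g a + 2⁻¹ * k a) ∂m).toReal := by
  have i₁ := (hg.integrable_toReal h).const_mul 2⁻¹
  have i₂ := (hk.integrable_toReal h).const_mul 2⁻¹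
  have hgk := hg.half_add hk h hΔ
  have i₃ := hgk.integrable_toReal h
  refine ⟨(i₁.add i₂).sub i₃, ?_⟩
  rw [hg.toReal_lintegral h, hk.toReal_lintegral h, hgk.toReal_lintegral h,
    ← integral_const_mul, ← integral_const_mul, ← integral_add i₁ i₂,
    ← integral_sub (by exact i₁.add i₂) i₃]

lemma toReal_lintegral_half_add_le (hg : FinMod m F g) (hk : FinMod m F k)
    (h : SmoothIntegrand F b) (hΔ : Delta2 m F) :
    (∫⁻ a, F a (2⁻¹ * g a + 2⁻¹ * k a) ∂m).toReal ≤
      2⁻¹ * (∫⁻ a, F a (g a) ∂m).toReal + 2⁻¹ * (∫⁻ a, F a (k a) ∂m).toReal := by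
  rw [← sub_nonneg, ← (hg.integral_half_add_defect hk h hΔ).2]
  exact integral_nonneg fun a => sub_nonneg.2 (h.toReal_half_add_le a (g a) (k a))

lemma ae_eq_of_le_toReal_lintegral_half_add (hg : FinMod m F g) (hk : FinMod m F k)
    (h : SmoothIntegrand F b) (hΔ : Delta2 m F)
    (hle : 2⁻¹ * (∫⁻ a, F a (g a) ∂m).toReal + 2⁻¹ * (∫⁻ a, F a (k a) ∂m).toReal ≤
      (∫⁻ a, F a (2⁻¹ * g a + 2⁻¹ * k a) ∂m).toReal) :
    ∀ᵐ a ∂m, (F a (2⁻¹ * g a + 2⁻¹ * k a)).toReal =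
      2⁻¹ * (F a (g a)).toReal + 2⁻¹ * (F a (k a)).toReal := by
  obtain ⟨hi, heq⟩ := hg.integral_half_add_defect hk h hΔ
  have hnn : 0 ≤ fun a => 2⁻¹ * (F a (g a)).toReal + 2⁻¹ * (F a (k a)).toReal -
      (F a (2⁻¹ * g a + 2⁻¹ * k a)).toReal :=
    fun a => sub_nonneg.2 (h.toReal_half_add_le a (g a) (k a))
  have h0 := (integral_eq_zero_iff_of_nonneg hnn hi).1
    (le_antisymm (heq.trans_le (sub_nonpos.2 hle)) (integral_nonneg hnn))
  filter_upwards [h0] with a ha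
  exact (sub_eq_zero.1 ha).symm

/-- The first variation is continuous along lines. The integrand is monotone in `t`, so that its
values at `t = ±1` dominate. -/
lemma tendsto_integral_mul (hg : FinMod m F g) (hk : FinMod m F k) (h : SmoothIntegrand F b)
    (hΔ : Delta2 m F) :
    Tendsto (fun t : ℝ => ∫ a, b a (g a + t * k a) * k a ∂m) (𝓝 0)
      (𝓝 (∫ a, b a (g a) * k a ∂m)) := by
  have hline : ∀ t : ℝ, FinMod m F fun a => g a + t * k a :=
    fun t => hg.add (hk.const_mul h hΔ t) h hΔ
  have hmono : ∀ a, Monotone fun t : ℝ => b a (g a + t * k a) * k a := fun a s t hst => by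
    rcases le_total 0 (k a) with h0 | h0
    · exact mul_le_mul_of_nonneg_right (h.monotone a (by gcongr)) h0
    · refine mul_le_mul_of_nonpos_right (h.monotone a ?_) h0
      nlinarith
  refine tendsto_integral_filter_of_dominated_convergence
    (fun a => |b a (g a + 1 * k a) * k a| + |b a (g a + (-1) * k a) * k a|) ?_ ?_ ?_ ?_
  · exact Eventually.of_forall fun t => ((hline t).integrable_mul hk h hΔ).aestronglyMeasurable
  · filter_upwards [Icc_mem_nhds (show (-1 : ℝ) < 0 by norm_num) (show (0 : ℝ) < 1 by norm_num)]
      with t ht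
    refine Eventually.of_forall fun a => ?_
    have h1 := hmono a ht.1
    have h2 := hmono a ht.2
    rw [Real.norm_eq_abs, abs_le]
    simp only at h1 h2
    constructor
    · linarith [neg_abs_le (b a (g a + (-1) * k a) * k a), abs_nonneg (b a (g a + 1 * k a) * k a)]
    · linarith [le_abs_self (b a (g a + 1 * k a) * k a), abs_nonneg (b a (g a + (-1) * k a) * k a)]
  · exact ((hline 1).integrable_mul hk h hΔ).abs.add ((hline (-1)).integrable_mul hk h hΔ).abs
  · refine Eventually.of_forall fun a => ?_
    have hc : Continuous fun t : ℝ => b a (g a + t * k a) * k a :=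
      ((h.continuous a).comp (by fun_prop)).mul continuous_const
    simpa using hc.tendsto 0

end FinMod

end Integrand

/-! ### The Luxemburg gauge -/

section Gauge

variable {α : Type*} [MeasurableSpace α]
variable {F : α → ℝ → ℝ≥0∞} {b : α → ℝ → ℝ} {m : Measure α} {g k : α → ℝ}

/-- The Minkowski functional of the unit ball of the modular `∫ F(a, g(a)) dm(a)`. -/
noncomputable def gauge (m : Measure α) (F : α → ℝ → ℝ≥0∞) (g : α → ℝ) : ℝ≥0∞ :=
  ⨅ (l : ℝ) (_ : 0 < l ∧ ∫⁻ a, F a (g a / l) ∂m ≤ 1), ENNReal.ofReal l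

lemma gauge_congr (h : g =ᵐ[m] k) : gauge m F g = gauge m F k := by
  have : ∀ l : ℝ, ∫⁻ a, F a (g a / l) ∂m = ∫⁻ a, F a (k a / l) ∂m := fun l =>
    lintegral_congr_ae (h.mono fun a ha => by simp only [ha])
  simp only [gauge, this]

lemma gauge_mono (h : SmoothIntegrand F b) (hkg : ∀ a, |k a| ≤ |g a|) :
    gauge m F k ≤ gauge m F g := by
  refine le_iInf₂ fun l hl => iInf₂_le l ⟨hl.1, le_trans (lintegral_mono fun a => ?_) hl.2⟩
  refine h.mono_abs a ?_
  rw [abs_div, abs_div]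
  exact div_le_div_of_nonneg_right (hkg a) (abs_nonneg l)

lemma gauge_add_le (h : SmoothIntegrand F b) (hg : AEMeasurable g m) :
    gauge m F (fun a => g a + k a) ≤ gauge m F g + gauge m F k := by
  simp only [gauge, ENNReal.iInf_add, ENNReal.add_iInf]
  refine le_iInf₂ fun r hr => le_iInf₂ fun l hl => ?_
  obtain ⟨hl0, hl⟩ := hl
  obtain ⟨hr0, hr⟩ := hr
  have hlr : 0 < l + r := add_pos hl0 hr0
  rw [← ENNReal.ofReal_add hl0.le hr0.le]
  refine iInf₂_le (l + r) ⟨hlr, ?_⟩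
  have hsum : l / (l + r) + r / (l + r) = 1 := by field_simp
  calc ∫⁻ a, F a ((g a + k a) / (l + r)) ∂m
      ≤ ∫⁻ a, ENNReal.ofReal (l / (l + r)) * F a (g a / l) +
          ENNReal.ofReal (r / (l + r)) * F a (k a / r) ∂m := by
        refine lintegral_mono fun a => ?_
        have := h.convex a (g a / l) (k a / r) (l / (l + r)) (r / (l + r)) (by positivity)
          (by positivity) hsum
        convert this using 2
        field_simp
    _ = ENNReal.ofReal (l / (l + r)) * ∫⁻ a, F a (g a / l) ∂m +
          ENNReal.ofReal (r / (l + r)) * ∫⁻ a, F a (k a / r) ∂m := by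
        rw [lintegral_add_left' ((h.aemeasurable_left (hg.div_const l)).const_mul _),
          lintegral_const_mul' _ _ ENNReal.ofReal_ne_top,
          lintegral_const_mul' _ _ ENNReal.ofReal_ne_top]
    _ ≤ ENNReal.ofReal (l / (l + r)) * 1 + ENNReal.ofReal (r / (l + r)) * 1 := by gcongr
    _ = 1 := by
        rw [mul_one, mul_one, ← ENNReal.ofReal_add (by positivity) (by positivity), hsum,
          ENNReal.ofReal_one]

end Gauge

/-! ### The space `W`, its seminorm and the restriction to `Ω` -/

section Space

variable {X : Type*} [MeasurableSpace X] {μ : Measure X} {Ω : Set X}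
variable {Φ : X → X → ℝ → ℝ≥0∞} {φ : X → X → ℝ → ℝ}

lemma KernelDeriv.smoothIntegrand (hφ : KernelDeriv Φ φ) (hΦ : KernelCond Φ) :
    SmoothIntegrand (fun p : X × X => Φ p.1 p.2) fun p => φ p.1 p.2 where
  measurable_left := hΦ.measurable
  measurable := hφ.measurable
  zero _ := hφ.zero _ _
  continuous _ := hφ.continuous _ _
  monotone _ := hφ.monotone _ _
  odd _ := hφ.odd _ _
  integral _ := hφ.integral _ _
  convex _ := hΦ.convex _ _

/-- The increment `g(x) - g(y)` as a function of the pair `(x,y)`. -/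
def incr (g : X → ℝ) (p : X × X) : ℝ := g p.1 - g p.2

lemma incr_congr {g k : X → ℝ} (h : g =ᵐ[μ] k) : incr g =ᵐ[μ.prod μ] incr k := by
  filter_upwards [Measure.quasiMeasurePreserving_fst.ae (p := fun x => g x = k x) h,
    Measure.quasiMeasurePreserving_snd.ae (p := fun x => g x = k x) h] with p h1 h2
  simp only [incr, h1, h2]

lemma incr_add (u v : X →ₘ[μ] ℝ) :
    incr (u + v : X →ₘ[μ] ℝ) =ᵐ[μ.prod μ] fun p => incr u p + incr v p :=
  (incr_congr (AEEqFun.coeFn_add u v)).trans <| .of_forall fun p => by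
    simp only [incr, Pi.add_apply]; ring

lemma incr_smul (c : ℝ) (u : X →ₘ[μ] ℝ) :
    incr (c • u : X →ₘ[μ] ℝ) =ᵐ[μ.prod μ] fun p => c * incr u p :=
  (incr_congr (AEEqFun.coeFn_smul c u)).trans <| .of_forall fun p => by
    simp only [incr, Pi.smul_apply, smul_eq_mul]; ring

lemma aemeasurable_incr (u : X →ₘ[μ] ℝ) : AEMeasurable (incr u) (μ.prod μ) :=
  ((u.measurable.comp measurable_fst).sub (u.measurable.comp measurable_snd)).aemeasurable

lemma mem_W_iff (hS : SmoothIntegrand (fun p : X × X => Φ p.1 p.2) fun p => φ p.1 p.2)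
    (hΔ : Delta2 (μ.prod μ) fun p => Φ p.1 p.2) {u : X →ₘ[μ] ℝ} :
    u ∈ W μ Ω Φ ↔
      FinMod (μ.prod μ) (fun p => Φ p.1 p.2) (incr u) ∧ MemLp u 2 (μ.restrict Ω) := by
  rw [FinMod.iff_exists hS hΔ]
  exact and_congr_left fun _ => (and_iff_right (aemeasurable_incr u)).symm

lemma add_mem_W (hS : SmoothIntegrand (fun p : X × X => Φ p.1 p.2) fun p => φ p.1 p.2)
    (hΔ : Delta2 (μ.prod μ) fun p => Φ p.1 p.2) {u v : X →ₘ[μ] ℝ}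
    (hu : u ∈ W μ Ω Φ) (hv : v ∈ W μ Ω Φ) : u + v ∈ W μ Ω Φ := by
  rw [mem_W_iff hS hΔ] at *
  exact ⟨(hu.1.add hv.1 hS hΔ).congr (incr_add u v).symm,
    (memLp_congr_ae (ae_restrict_of_ae (AEEqFun.coeFn_add u v))).2 (hu.2.add hv.2)⟩

lemma smul_mem_W (hS : SmoothIntegrand (fun p : X × X => Φ p.1 p.2) fun p => φ p.1 p.2)
    (hΔ : Delta2 (μ.prod μ) fun p => Φ p.1 p.2) (c : ℝ) {u : X →ₘ[μ] ℝ}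
    (hu : u ∈ W μ Ω Φ) : c • u ∈ W μ Ω Φ := by
  rw [mem_W_iff hS hΔ] at *
  exact ⟨(hu.1.const_mul hS hΔ c).congr (incr_smul c u).symm,
    (memLp_congr_ae (ae_restrict_of_ae (AEEqFun.coeFn_smul c u))).2 (hu.2.const_smul c)⟩

lemma sub_mem_W (hS : SmoothIntegrand (fun p : X × X => Φ p.1 p.2) fun p => φ p.1 p.2)
    (hΔ : Delta2 (μ.prod μ) fun p => Φ p.1 p.2) {u v : X →ₘ[μ] ℝ}
    (hu : u ∈ W μ Ω Φ) (hv : v ∈ W μ Ω Φ) : u - v ∈ W μ Ω Φ := by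
  rw [sub_eq_add_neg, ← neg_one_smul ℝ v]
  exact add_mem_W hS hΔ hu (smul_mem_W hS hΔ _ hv)

lemma normW_eq (u : X →ₘ[μ] ℝ) :
    normW μ Ω Φ u =
      eLpNorm u 2 (μ.restrict Ω) + gauge (μ.prod μ) (fun p => Φ p.1 p.2) (incr u) := rfl

lemma normW_add_le (hS : SmoothIntegrand (fun p : X × X => Φ p.1 p.2) fun p => φ p.1 p.2)
    (u v : X →ₘ[μ] ℝ) : normW μ Ω Φ (u + v) ≤ normW μ Ω Φ u + normW μ Ω Φ v := by
  rw [normW_eq, normW_eq, normW_eq, gauge_congr (incr_add u v),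
    eLpNorm_congr_ae (ae_restrict_of_ae (AEEqFun.coeFn_add u v)), add_add_add_comm]
  exact add_le_add (eLpNorm_add_le u.aestronglyMeasurable.restrict
    v.aestronglyMeasurable.restrict one_le_two) (gauge_add_le hS (aemeasurable_incr u))

lemma abs_incr_abs_le {Y : Type*} (g : Y → ℝ) (p : Y × Y) : |incr (fun x => |g x|) p| ≤ |incr g p| :=
  abs_abs_sub_abs_le_abs_sub _ _

lemma abs_mem_W (hS : SmoothIntegrand (fun p : X × X => Φ p.1 p.2) fun p => φ p.1 p.2)
    (hΔ : Delta2 (μ.prod μ) fun p => Φ p.1 p.2) {u : X →ₘ[μ] ℝ}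
    (hu : u ∈ W μ Ω Φ) : |u| ∈ W μ Ω Φ := by
  rw [mem_W_iff hS hΔ] at *
  have hc := AEEqFun.coeFn_abs u
  refine ⟨FinMod.congr (k := incr (|u| : X →ₘ[μ] ℝ)) (hu.1.mono hS
      ((aemeasurable_incr |u|).congr (incr_congr hc)) (abs_incr_abs_le u)) (incr_congr hc).symm,
    (memLp_congr_ae (ae_restrict_of_ae hc)).2 hu.2.norm⟩

lemma normW_abs_le (hS : SmoothIntegrand (fun p : X × X => Φ p.1 p.2) fun p => φ p.1 p.2)
    (u : X →ₘ[μ] ℝ) : normW μ Ω Φ |u| ≤ normW μ Ω Φ u := by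
  have hc := AEEqFun.coeFn_abs u
  rw [normW_eq, normW_eq, gauge_congr (incr_congr hc), eLpNorm_congr_ae (ae_restrict_of_ae hc)]
  exact add_le_add (eLpNorm_norm u).le (gauge_mono hS (abs_incr_abs_le u))

lemma restr_eq_toLp {u : X →ₘ[μ] ℝ} (hu : MemLp u 2 (μ.restrict Ω)) :
    restr μ Ω u = hu.toLp u := dif_pos hu

lemma restr_add {u v : X →ₘ[μ] ℝ} (hu : u ∈ W μ Ω Φ) (hv : v ∈ W μ Ω Φ) :
    restr μ Ω (u + v) = restr μ Ω u + restr μ Ω v := by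
  have hc := ae_restrict_of_ae (s := Ω) (AEEqFun.coeFn_add u v)
  rw [restr_eq_toLp hu.2, restr_eq_toLp hv.2,
    restr_eq_toLp ((memLp_congr_ae hc).2 (hu.2.add hv.2)), ← MemLp.toLp_add]
  exact MemLp.toLp_congr _ _ hc

lemma restr_smul (c : ℝ) {u : X →ₘ[μ] ℝ} (hu : u ∈ W μ Ω Φ) :
    restr μ Ω (c • u) = c • restr μ Ω u := by
  have hc := ae_restrict_of_ae (s := Ω) (AEEqFun.coeFn_smul c u)
  rw [restr_eq_toLp hu.2, restr_eq_toLp ((memLp_congr_ae hc).2 (hu.2.const_smul c)),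
    ← MemLp.toLp_const_smul]
  exact MemLp.toLp_congr _ _ hc

lemma restr_sub {u v : X →ₘ[μ] ℝ} (hu : u ∈ W μ Ω Φ) (hv : v ∈ W μ Ω Φ) :
    restr μ Ω (u - v) = restr μ Ω u - restr μ Ω v := by
  have hc := ae_restrict_of_ae (s := Ω) (AEEqFun.coeFn_sub u v)
  rw [restr_eq_toLp hu.2, restr_eq_toLp hv.2,
    restr_eq_toLp ((memLp_congr_ae hc).2 (hu.2.sub hv.2)), ← MemLp.toLp_sub]
  exact MemLp.toLp_congr _ _ hc

lemma integrable_indicator_mul (hΩ : MeasurableSet Ω) (f : Lp ℝ 2 (μ.restrict Ω))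
    {v : X →ₘ[μ] ℝ} (hv : MemLp v 2 (μ.restrict Ω)) :
    Integrable (fun x => Ω.indicator f x * v x) μ := by
  have h1 : (fun x => Ω.indicator f x * v x) = Ω.indicator fun x => f x * v x := by
    funext x
    rw [Set.indicator_mul_left]
  rw [h1, integrable_indicator_iff hΩ]
  exact (Lp.memLp f).integrable_mul hv

lemma inner_restr (hΩ : MeasurableSet Ω) (f : Lp ℝ 2 (μ.restrict Ω))
    {v : X →ₘ[μ] ℝ} (hv : MemLp v 2 (μ.restrict Ω)) :
    inner ℝ f (restr μ Ω v) = ∫ x, Ω.indicator f x * v x ∂μ := by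
  have h1 : (fun x => Ω.indicator f x * v x) = Ω.indicator fun x => f x * v x := by
    funext x
    rw [Set.indicator_mul_left]
  rw [h1, integral_indicator hΩ, restr_eq_toLp hv, L2.inner_def]
  refine integral_congr_ae ?_
  filter_upwards [hv.coeFn_toLp] with x hx
  simp [hx, mul_comm]

end Space

/-! ### Capacity and quasi-continuous representatives -/

section Capacity

variable {X K : Type*} [MeasurableSpace X] [TopologicalSpace K]
variable {μ : Measure X} {Ω : Set X}
variable {Φ : X → X → ℝ → ℝ≥0∞} {φ : X → X → ℝ → ℝ} {ι : X → K}

lemma cap_mono {A A' : Set K} (h : A ⊆ A') : cap μ Ω Φ ι A ≤ cap μ Ω Φ ι A' := by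
  refine le_iInf₂ fun w hw => ?_
  obtain ⟨hw, U, hU, hAU, hwU⟩ := hw
  refine (iInf₂_le w ⟨hw, U, hU, h.trans hAU, hwU⟩).trans ?_
  gcongr

/-- Adding a `μ`-null set does not increase the capacity, provided that the result is open. -/
lemma cap_union_le_of_null {A N : Set K} (hAN : IsOpen (A ∪ N)) (hN : ∀ᵐ x ∂μ, ι x ∉ N) :
    cap μ Ω Φ ι (A ∪ N) ≤ cap μ Ω Φ ι A := by
  refine le_iInf₂ fun w hw => ?_
  obtain ⟨hw, U, hU, hAU, hwU⟩ := hw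
  have h1 : ∀ᵐ x ∂μ, ι x ∈ U ∪ (A ∪ N) → 1 ≤ w x := by
    filter_upwards [hwU, hN] with x h1 h2 h3
    refine h1 ?_
    rcases h3 with h3 | h3 | h3
    exacts [h3, hAU h3, absurd h3 h2]
  have h2 : μ (ι ⁻¹' (A ∪ N) \ Ω) ≤ μ (ι ⁻¹' A \ Ω) := by
    refine measure_mono_ae ?_
    filter_upwards [hN] with x h2 h3
    exact ⟨h3.1.resolve_right h2, h3.2⟩
  exact (iInf₂_le w ⟨hw, U ∪ (A ∪ N), hU.union hAN, subset_union_right, h1⟩).trans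
    (add_le_add_right h2 _)

/-- The capacity is subadditive up to a constant: if `w` and `v` are admissible for the two sets,
then `|w| + |v|` is admissible for their union. -/
lemma cap_union_le (hS : SmoothIntegrand (fun p : X × X => Φ p.1 p.2) fun p => φ p.1 p.2)
    (hΔ : Delta2 (μ.prod μ) fun p => Φ p.1 p.2) {A A' : Set K} :
    cap μ Ω Φ ι (A ∪ A') ≤ 4 * (cap μ Ω Φ ι A + cap μ Ω Φ ι A') := by
  have h4 : (4 : ℝ≥0∞) ≠ 0 := by norm_num
  have h4' : (4 : ℝ≥0∞) ≠ ⊤ := by norm_num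
  simp only [cap, ENNReal.iInf_add, ENNReal.add_iInf, ENNReal.mul_iInf_of_ne h4 h4']
  refine le_iInf₂ fun v hv => le_iInf₂ fun w hw => ?_
  obtain ⟨hw, U, hU, hAU, hwU⟩ := hw
  obtain ⟨hv, V, hV, hAV, hvV⟩ := hv
  have h1 : ∀ᵐ x ∂μ, ι x ∈ U ∪ V → 1 ≤ (|w| + |v|) x := by
    filter_upwards [hwU, hvV, AEEqFun.coeFn_add |w| |v|, AEEqFun.coeFn_abs w,
      AEEqFun.coeFn_abs v] with x h1 h2 h3 h4 h5 h6
    rw [h3, Pi.add_apply, h4, h5]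
    rcases h6 with h6 | h6
    · linarith [h1 h6, le_abs_self (w x), abs_nonneg (v x)]
    · linarith [h2 h6, le_abs_self (v x), abs_nonneg (w x)]
  refine (iInf₂_le (|w| + |v|) ⟨add_mem_W hS hΔ (abs_mem_W hS hΔ hw) (abs_mem_W hS hΔ hv),
    U ∪ V, hU.union hV, union_subset_union hAU hAV, h1⟩).trans ?_
  have hn : normW μ Ω Φ (|w| + |v|) ^ 2 ≤
      4 * (normW μ Ω Φ w ^ 2 + normW μ Ω Φ v ^ 2) := by
    have h1 : normW μ Ω Φ (|w| + |v|) ≤ normW μ Ω Φ w + normW μ Ω Φ v :=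
      (normW_add_le hS _ _).trans (add_le_add (normW_abs_le hS w) (normW_abs_le hS v))
    generalize normW μ Ω Φ w = a at *
    generalize normW μ Ω Φ v = c at *
    have h2 : a + c ≤ 2 * max a c := by
      rw [two_mul]; exact add_le_add (le_max_left _ _) (le_max_right _ _)
    have h3 : max a c ^ 2 ≤ a ^ 2 + c ^ 2 := by
      rcases max_choice a c with h | h <;> rw [h]
      exacts [le_self_add, le_add_self]
    calc normW μ Ω Φ (|w| + |v|) ^ 2 ≤ (2 * max a c) ^ 2 := by
          gcongr; exact h1.trans h2
      _ = 4 * max a c ^ 2 := by rw [mul_pow]; norm_num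
      _ ≤ _ := by gcongr
  have hm : μ (ι ⁻¹' (A ∪ A') \ Ω) ≤ 4 * (μ (ι ⁻¹' A \ Ω) + μ (ι ⁻¹' A' \ Ω)) := by
    rw [preimage_union, union_sdiff_distrib]
    refine (measure_union_le _ _).trans (le_mul_of_one_le_left' ?_)
    norm_num
  calc _ ≤ 4 * (normW μ Ω Φ w ^ 2 + normW μ Ω Φ v ^ 2) +
        4 * (μ (ι ⁻¹' A \ Ω) + μ (ι ⁻¹' A' \ Ω)) := add_le_add hn hm
    _ = _ := by ring

namespace QuasiContinuous

variable {g k : K → ℝ}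

lemma add (hS : SmoothIntegrand (fun p : X × X => Φ p.1 p.2) fun p => φ p.1 p.2)
    (hΔ : Delta2 (μ.prod μ) fun p => Φ p.1 p.2) (hg : QuasiContinuous μ Ω Φ ι g)
    (hk : QuasiContinuous μ Ω Φ ι k) : QuasiContinuous μ Ω Φ ι fun x => g x + k x := by
  intro ε hε
  have h8 : 0 < ε / 8 := ENNReal.div_pos hε.ne' (by norm_num)
  obtain ⟨U, hU, hcU, hgU⟩ := hg _ h8
  obtain ⟨V, hV, hcV, hkV⟩ := hk _ h8
  refine ⟨U ∪ V, hU.union hV, ?_, ?_⟩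
  · calc cap μ Ω Φ ι (U ∪ V) ≤ 4 * (cap μ Ω Φ ι U + cap μ Ω Φ ι V) := cap_union_le hS hΔ
      _ ≤ 4 * (ε / 8 + ε / 8) := by gcongr
      _ = 8 * (ε / 8) := by ring
      _ ≤ ε := ENNReal.mul_div_le
  · rw [compl_union]
    exact (hgU.mono inter_subset_left).add (hkV.mono inter_subset_right)

lemma const_mul (c : ℝ) (hg : QuasiContinuous μ Ω Φ ι g) :
    QuasiContinuous μ Ω Φ ι fun x => c * g x := fun ε hε => by
  obtain ⟨U, hU, hcU, hgU⟩ := hg ε hε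
  exact ⟨U, hU, hcU, continuousOn_const.mul hgU⟩

variable [MeasurableSpace K] [BorelSpace K] {ν : Measure K}

lemma aemeasurable (hν : CapAbsCont μ Ω Φ ι ν) (hg : QuasiContinuous μ Ω Φ ι g) :
    AEMeasurable g ν := by
  choose U hU hcU hgU using fun n : ℕ => hg ((n : ℝ≥0∞) + 1)⁻¹ (by simp)
  have hnull : ν (⋂ n, U n) = 0 := by
    refine hν _ (MeasurableSet.iInter fun n => (hU n).measurableSet) ?_
    refine le_antisymm (ge_of_tendsto' ENNReal.tendsto_inv_nat_nhds_zero fun n => ?_) bot_le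
    refine (cap_mono (iInter_subset U n)).trans ((hcU n).trans ?_)
    exact ENNReal.inv_le_inv.2 le_self_add
  have h1 : AEMeasurable g (ν.restrict (⋃ n, (U n)ᶜ)) :=
    aemeasurable_iUnion_iff.2 fun n => (hgU n).aemeasurable (hU n).measurableSet.compl
  have h2 : (⋃ n, (U n)ᶜ) =ᵐ[ν] (univ : Set K) := by
    rw [← compl_iInter, ae_eq_univ, compl_compl]
    exact hnull
  rwa [Measure.restrict_congr_set h2, Measure.restrict_univ] at h1

/-- A quasi-continuous function vanishing `μ`-almost everywhere vanishes quasi-everywhere: its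
zeros form a relatively closed set outside an exceptional open set `U`, so that adding the `μ`-null
set of its non-zeros to `U` yields an open set of no larger capacity. -/
lemma ae_eq_zero (hν : CapAbsCont μ Ω Φ ι ν) (hg : QuasiContinuous μ Ω Φ ι g)
    (h0 : ∀ᵐ x ∂μ, g (ι x) = 0) : ∀ᵐ x ∂ν, g x = 0 := by
  choose U hU hcU hgU using fun n : ℕ => hg ((n : ℝ≥0∞) + 1)⁻¹ (by simp)
  have hopen : ∀ n, IsOpen (U n ∪ {x | g x ≠ 0}) := fun n => by
    have h1 := (hgU n).preimage_isClosed_of_isClosed (hU n).isClosed_compl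
      (isClosed_singleton (x := (0 : ℝ)))
    have h2 : U n ∪ {x | g x ≠ 0} = ((U n)ᶜ ∩ g ⁻¹' {0})ᶜ := by
      rw [compl_inter, compl_compl]; rfl
    rw [h2]
    exact h1.isOpen_compl
  have hnull : ν (⋂ n, (U n ∪ {x | g x ≠ 0})) = 0 := by
    refine hν _ (MeasurableSet.iInter fun n => (hopen n).measurableSet) ?_
    refine le_antisymm (ge_of_tendsto' ENNReal.tendsto_inv_nat_nhds_zero fun n => ?_) bot_le
    refine (cap_mono (iInter_subset _ n)).trans ?_
    refine (cap_union_le_of_null (hopen n) ?_).trans ((hcU n).trans ?_)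
    · filter_upwards [h0] with x hx using not_not.2 hx
    · exact ENNReal.inv_le_inv.2 le_self_add
  exact measure_mono_null (subset_iInter fun n => subset_union_right) hnull

end QuasiContinuous

namespace IsQCRep

variable {u v : X →ₘ[μ] ℝ} {g k : K → ℝ}

lemma add (hS : SmoothIntegrand (fun p : X × X => Φ p.1 p.2) fun p => φ p.1 p.2)
    (hΔ : Delta2 (μ.prod μ) fun p => Φ p.1 p.2) (hg : IsQCRep μ Ω Φ ι u g)
    (hk : IsQCRep μ Ω Φ ι v k) : IsQCRep μ Ω Φ ι (u + v) fun x => g x + k x := by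
  refine ⟨hg.1.add hS hΔ hk.1, ?_⟩
  filter_upwards [hg.2, hk.2, AEEqFun.coeFn_add u v] with x h1 h2 h3
  rw [h1, h2, h3, Pi.add_apply]

lemma smul (c : ℝ) (hg : IsQCRep μ Ω Φ ι u g) :
    IsQCRep μ Ω Φ ι (c • u) fun x => c * g x := by
  refine ⟨hg.1.const_mul c, ?_⟩
  filter_upwards [hg.2, AEEqFun.coeFn_smul c u] with x h1 h3
  rw [h1, h3, Pi.smul_apply, smul_eq_mul]

lemma qcRep_spec (hg : ∃ g, IsQCRep μ Ω Φ ι u g) : IsQCRep μ Ω Φ ι u (qcRep μ Ω Φ ι u) :=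
  Classical.epsilon_spec hg

/-- Quasi-continuous representatives are unique up to `ν`-null sets. -/
lemma qcRep_ae_eq [MeasurableSpace K] [BorelSpace K] {ν : Measure K}
    (hS : SmoothIntegrand (fun p : X × X => Φ p.1 p.2) fun p => φ p.1 p.2)
    (hΔ : Delta2 (μ.prod μ) fun p => Φ p.1 p.2) (hν : CapAbsCont μ Ω Φ ι ν)
    (hg : IsQCRep μ Ω Φ ι u g) : qcRep μ Ω Φ ι u =ᵐ[ν] g := by
  have h1 := qcRep_spec ⟨g, hg⟩
  have h2 := (h1.1.add hS hΔ (hg.1.const_mul (-1))).ae_eq_zero hν (by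
    filter_upwards [h1.2, hg.2] with x h3 h4
    rw [h3, h4]; ring)
  filter_upwards [h2] with x hx
  linarith

end IsQCRep

end Capacity

/-! ### The perturbed energy and its first variation -/

section Energy

variable {X K : Type*} [MeasurableSpace X] [TopologicalSpace K] [MeasurableSpace K]
variable {μ : Measure X} {Ω : Set X} {Φ : X → X → ℝ → ℝ≥0∞} {φ : X → X → ℝ → ℝ} {ι : X → K}
variable {B : K → ℝ → ℝ≥0∞} {β : K → ℝ → ℝ} {ν : Measure K}

omit [TopologicalSpace K] in
lemma PotentialDeriv.smoothIntegrand (hβ : PotentialDeriv B β) (hB : PotentialCond B) :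
    SmoothIntegrand B β where
  measurable_left := hB.measurable
  measurable := hβ.measurable
  zero := hβ.zero
  continuous := hβ.continuous
  monotone := hβ.monotone
  odd := hβ.odd
  integral := hβ.integral
  convex := hB.convex

variable (μ Ω Φ φ ι B β ν) in
/-- What the variational argument uses of the kernel, the potential and the measure `ν`. -/
structure EnergyData : Prop where
  kernel : SmoothIntegrand (fun p : X × X => Φ p.1 p.2) fun p => φ p.1 p.2
  kernel_delta2 : Delta2 (μ.prod μ) fun p => Φ p.1 p.2
  potential : SmoothIntegrand B β
  potential_delta2 : Delta2 ν B
  capAbsCont : CapAbsCont μ Ω Φ ι ν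

namespace EnergyData

variable {u v : X →ₘ[μ] ℝ}

lemma mem_WB_iff (H : EnergyData μ Ω Φ φ ι B β ν) :
    u ∈ WB μ Ω Φ ι B ν ↔
      u ∈ W μ Ω Φ ∧ (∃ g, IsQCRep μ Ω Φ ι u g) ∧ FinMod ν B (qcRep μ Ω Φ ι u) := by
  rw [FinMod.iff_exists H.potential H.potential_delta2]
  rfl

lemma finMod_incr (H : EnergyData μ Ω Φ φ ι B β ν) (hu : u ∈ WB μ Ω Φ ι B ν) :
    FinMod (μ.prod μ) (fun p => Φ p.1 p.2) (incr u) :=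
  ((mem_W_iff H.kernel H.kernel_delta2).1 hu.1).1

lemma finMod_qcRep (H : EnergyData μ Ω Φ φ ι B β ν) (hu : u ∈ WB μ Ω Φ ι B ν) :
    FinMod ν B (qcRep μ Ω Φ ι u) :=
  (H.mem_WB_iff.1 hu).2.2

lemma energyB_eq (hu : u ∈ WB μ Ω Φ ι B ν) :
    energyB μ Ω Φ ι B ν u = 2⁻¹ * (∫⁻ p : X × X, Φ p.1 p.2 (incr u p) ∂μ.prod μ) +
      ∫⁻ x, B x (qcRep μ Ω Φ ι u x) ∂ν := by
  rw [energyB, if_pos hu.2.1]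
  rfl

lemma energyB_lt_top (H : EnergyData μ Ω Φ φ ι B β ν) (hu : u ∈ WB μ Ω Φ ι B ν) :
    energyB μ Ω Φ ι B ν u < ⊤ := by
  rw [energyB_eq hu]
  exact ENNReal.add_lt_top.2 ⟨ENNReal.mul_lt_top (by simp) (H.finMod_incr hu).2,
    (H.finMod_qcRep hu).2⟩

lemma toReal_energyB (H : EnergyData μ Ω Φ φ ι B β ν) (hu : u ∈ WB μ Ω Φ ι B ν) :
    (energyB μ Ω Φ ι B ν u).toReal =
      1 / 2 * (∫⁻ p : X × X, Φ p.1 p.2 (incr u p) ∂μ.prod μ).toReal +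
        (∫⁻ x, B x (qcRep μ Ω Φ ι u x) ∂ν).toReal := by
  rw [energyB_eq hu, ENNReal.toReal_add (ENNReal.mul_lt_top (by simp) (H.finMod_incr hu).2).ne
    (H.finMod_qcRep hu).2.ne, ENNReal.toReal_mul]
  simp

lemma form_eq (u v : X →ₘ[μ] ℝ) :
    form Ω Φ ι φ β ν u v =
      1 / 2 * ∫ p : X × X, φ p.1 p.2 (incr u p) * incr v p ∂(μ.prod μ) +
        ∫ x, β x (qcRep μ Ω Φ ι u x) * qcRep μ Ω Φ ι v x ∂ν := rfl

variable [BorelSpace K]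

lemma qcRep_add (H : EnergyData μ Ω Φ φ ι B β ν) (hu : u ∈ WB μ Ω Φ ι B ν)
    (hv : v ∈ WB μ Ω Φ ι B ν) :
    qcRep μ Ω Φ ι (u + v) =ᵐ[ν] fun x => qcRep μ Ω Φ ι u x + qcRep μ Ω Φ ι v x :=
  ((IsQCRep.qcRep_spec hu.2.1).add H.kernel H.kernel_delta2
    (IsQCRep.qcRep_spec hv.2.1)).qcRep_ae_eq H.kernel H.kernel_delta2 H.capAbsCont

lemma qcRep_smul (H : EnergyData μ Ω Φ φ ι B β ν) (c : ℝ) (hu : u ∈ WB μ Ω Φ ι B ν) :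
    qcRep μ Ω Φ ι (c • u) =ᵐ[ν] fun x => c * qcRep μ Ω Φ ι u x :=
  ((IsQCRep.qcRep_spec hu.2.1).smul c).qcRep_ae_eq H.kernel H.kernel_delta2 H.capAbsCont

lemma add_mem_WB (H : EnergyData μ Ω Φ φ ι B β ν) (hu : u ∈ WB μ Ω Φ ι B ν)
    (hv : v ∈ WB μ Ω Φ ι B ν) : u + v ∈ WB μ Ω Φ ι B ν :=
  H.mem_WB_iff.2 ⟨add_mem_W H.kernel H.kernel_delta2 hu.1 hv.1,
    ⟨_, (IsQCRep.qcRep_spec hu.2.1).add H.kernel H.kernel_delta2 (IsQCRep.qcRep_spec hv.2.1)⟩,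
    ((H.finMod_qcRep hu).add (H.finMod_qcRep hv) H.potential H.potential_delta2).congr
      (H.qcRep_add hu hv).symm⟩

lemma smul_mem_WB (H : EnergyData μ Ω Φ φ ι B β ν) (c : ℝ) (hu : u ∈ WB μ Ω Φ ι B ν) :
    c • u ∈ WB μ Ω Φ ι B ν :=
  H.mem_WB_iff.2 ⟨smul_mem_W H.kernel H.kernel_delta2 c hu.1,
    ⟨_, (IsQCRep.qcRep_spec hu.2.1).smul c⟩,
    ((H.finMod_qcRep hu).const_mul H.potential H.potential_delta2 c).congr
      (H.qcRep_smul c hu).symm⟩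

lemma sub_mem_WB (H : EnergyData μ Ω Φ φ ι B β ν) (hu : u ∈ WB μ Ω Φ ι B ν)
    (hv : v ∈ WB μ Ω Φ ι B ν) : u - v ∈ WB μ Ω Φ ι B ν := by
  rw [sub_eq_add_neg, ← neg_one_smul ℝ v]
  exact H.add_mem_WB hu (H.smul_mem_WB _ hv)

/-- The effective domain of the perturbed energy is `W ∩ L^B(ν)`. -/
lemma mem_WB_of_energyB_lt_top (H : EnergyData μ Ω Φ φ ι B β ν) (hu : u ∈ W μ Ω Φ)
    (hE : energyB μ Ω Φ ι B ν u < ⊤) : u ∈ WB μ Ω Φ ι B ν := by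
  by_cases hg : ∃ g, IsQCRep μ Ω Φ ι u g
  · rw [energyB, if_pos hg] at hE
    exact H.mem_WB_iff.2 ⟨hu, hg, (IsQCRep.qcRep_spec hg).1.aemeasurable H.capAbsCont,
      (ENNReal.add_lt_top.1 hE).2⟩
  · rw [energyB, if_neg hg, add_top] at hE
    exact absurd hE (lt_irrefl _)

/-- The form is the subgradient of the perturbed energy on `W ∩ L^B(ν)`. -/
lemma toReal_energyB_add_form_le (H : EnergyData μ Ω Φ φ ι B β ν)
    (hu : u ∈ WB μ Ω Φ ι B ν) (hv : v ∈ WB μ Ω Φ ι B ν) :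
    (energyB μ Ω Φ ι B ν u).toReal + form Ω Φ ι φ β ν u v ≤
      (energyB μ Ω Φ ι B ν (u + v)).toReal := by
  have h1 := (H.finMod_incr hu).toReal_lintegral_add_le (H.finMod_incr hv) H.kernel
    H.kernel_delta2
  have h2 := (H.finMod_qcRep hu).toReal_lintegral_add_le (H.finMod_qcRep hv) H.potential
    H.potential_delta2
  have h3 : ∫⁻ p : X × X, Φ p.1 p.2 (incr (u + v : X →ₘ[μ] ℝ) p) ∂μ.prod μ =
      ∫⁻ p : X × X, Φ p.1 p.2 (incr u p + incr v p) ∂μ.prod μ :=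
    lintegral_congr_ae ((incr_add u v).mono fun p hp => by simp only [hp])
  have h4 : ∫⁻ x, B x (qcRep μ Ω Φ ι (u + v) x) ∂ν =
      ∫⁻ x, B x (qcRep μ Ω Φ ι u x + qcRep μ Ω Φ ι v x) ∂ν :=
    lintegral_congr_ae ((H.qcRep_add hu hv).mono fun p hp => by simp only [hp])
  rw [H.toReal_energyB hu, H.toReal_energyB (H.add_mem_WB hu hv), form_eq, h3, h4]
  linarith

lemma form_smul_right (H : EnergyData μ Ω Φ φ ι B β ν) (u : X →ₘ[μ] ℝ) (c : ℝ)
    (hv : v ∈ WB μ Ω Φ ι B ν) :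
    form Ω Φ ι φ β ν u (c • v) = c * form Ω Φ ι φ β ν u v := by
  have h3 : ∫ p : X × X, φ p.1 p.2 (incr u p) * incr (c • v : X →ₘ[μ] ℝ) p ∂μ.prod μ =
      c * ∫ p : X × X, φ p.1 p.2 (incr u p) * incr v p ∂μ.prod μ := by
    rw [← integral_const_mul]
    refine integral_congr_ae ((incr_smul c v).mono fun p hp => ?_)
    simp only [hp]
    ring
  have h4 : ∫ x, β x (qcRep μ Ω Φ ι u x) * qcRep μ Ω Φ ι (c • v) x ∂ν =
      c * ∫ x, β x (qcRep μ Ω Φ ι u x) * qcRep μ Ω Φ ι v x ∂ν := by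
    rw [← integral_const_mul]
    refine integral_congr_ae ((H.qcRep_smul c hv).mono fun p hp => ?_)
    simp only [hp]
    ring
  rw [form_eq, form_eq, h3, h4]
  ring

lemma tendsto_form (H : EnergyData μ Ω Φ φ ι B β ν) (hu : u ∈ WB μ Ω Φ ι B ν)
    (hv : v ∈ WB μ Ω Φ ι B ν) :
    Tendsto (fun t : ℝ => form Ω Φ ι φ β ν (u + t • v) v) (𝓝 0)
      (𝓝 (form Ω Φ ι φ β ν u v)) := by
  have h1 := (H.finMod_incr hu).tendsto_integral_mul (H.finMod_incr hv) H.kernel H.kernel_delta2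
  have h2 := (H.finMod_qcRep hu).tendsto_integral_mul (H.finMod_qcRep hv) H.potential
    H.potential_delta2
  refine ((Tendsto.const_mul (1 / 2 : ℝ) h1).add h2).congr fun t => ?_
  rw [form_eq]
  congr 1
  · congr 1
    refine integral_congr_ae ?_
    filter_upwards [incr_add u (t • v), incr_smul t v] with p hp hp'
    rw [hp, hp']
  · refine integral_congr_ae ?_
    filter_upwards [H.qcRep_add hu (H.smul_mem_WB t hv), H.qcRep_smul t hv] with p hp hp'
    rw [hp, hp']

/-- The form is the only subgradient of the perturbed energy: if the energy lies above an affine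
function of slope `c` along the line through `u` in the direction `v`, touching it at `u`, then `c`
is the first variation in this direction. -/
lemma form_eq_of_support (H : EnergyData μ Ω Φ φ ι B β ν) (hu : u ∈ WB μ Ω Φ ι B ν)
    (hv : v ∈ WB μ Ω Φ ι B ν) {c : ℝ}
    (hc : ∀ t : ℝ, (energyB μ Ω Φ ι B ν u).toReal + t * c ≤
      (energyB μ Ω Φ ι B ν (u + t • v)).toReal) :
    form Ω Φ ι φ β ν u v = c := by
  -- the subgradient inequality at `u + t • v`, in the direction back to `u`
  have key : ∀ t : ℝ, t * c ≤ t * form Ω Φ ι φ β ν (u + t • v) v := fun t => by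
    have h1 := H.toReal_energyB_add_form_le (H.add_mem_WB hu (H.smul_mem_WB t hv))
      (H.smul_mem_WB (-t) hv)
    rw [H.form_smul_right _ _ hv, neg_smul, add_neg_cancel_right] at h1
    linarith [hc t]
  have hlim := H.tendsto_form hu hv
  apply le_antisymm
  · refine le_of_tendsto (hlim.mono_left (nhdsWithin_le_nhds (s := Iio 0))) ?_
    filter_upwards [self_mem_nhdsWithin] with t ht
    exact (mul_le_mul_left_of_neg ht).1 (key t)
  · refine ge_of_tendsto (hlim.mono_left (nhdsWithin_le_nhds (s := Ioi 0))) ?_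
    filter_upwards [self_mem_nhdsWithin] with t ht
    exact (mul_le_mul_iff_right₀ ht).1 (key t)

end EnergyData

end Energy

/-! ### Thick sets of pairs -/

/-- A function that vanishes on `Ω` and has vanishing increments on a thick set vanishes: the
property of vanishing passes from `A j n` to `B (j + 1) n`. -/
lemma Thick.ae_eq_zero {X : Type*} [MeasurableSpace X] {μ : Measure X} [SFinite μ]
    {Ω : Set X} {S : Set (X × X)} (hS : Thick μ Ω S)
    {v : X → ℝ} (hΩ : ∀ᵐ x ∂μ, x ∈ Ω → v x = 0)
    (hv : ∀ᵐ p ∂μ.prod μ, p ∈ S → v p.1 = v p.2) : ∀ᵐ x ∂μ, v x = 0 := by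
  obtain ⟨A, B, -, -, hAΩ, hAB, hunion, hcompl⟩ := hS
  have hv' := Measure.ae_ae_of_ae_prod hv
  have key : ∀ j, ∀ᵐ x ∂μ, ∀ n, x ∈ A j n → v x = 0 := fun j => by
    induction j with
    | zero => filter_upwards [hΩ] with x hx n hn using hx (hAΩ n hn)
    | succ j ih =>
      have hBzero : ∀ n, 0 < μ (A j n) → ∀ᵐ y ∂μ, y ∈ B (j + 1) n → v y = 0 := fun n hn => by
        obtain ⟨x, hxA, hx, hxv⟩ :=
          ((frequently_ae_mem_iff.2 hn.ne').and_eventually (ih.and hv')).exists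
        filter_upwards [hxv] with y hy hyB
        rw [← hy (hAB j n hn ⟨hxA, hyB⟩), hx n hxA]
      filter_upwards [ae_all_iff.2 fun n => ae_all_iff.2 (hBzero n)] with x hx n hn
      have hmem : x ∈ ⋃ n ∈ {n | 0 < μ (A j n)}, B (j + 1) n :=
        hunion j ▸ mem_iUnion.2 ⟨n, hn⟩
      obtain ⟨k, hk, hxk⟩ := mem_iUnion₂.1 hmem
      exact hx k hk hxk
  have hcov : ∀ᵐ x ∂μ, x ∈ ⋃ j, ⋃ n ∈ {n | 0 < μ (A j n)}, A j n := hcompl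
  filter_upwards [ae_all_iff.2 key, hcov] with x hx hmem
  obtain ⟨j, hj⟩ := mem_iUnion.1 hmem
  obtain ⟨n, -, hxn⟩ := mem_iUnion₂.1 hj
  exact hx j n hxn

/-! ### Elliptic extensions and Robin solutions -/

section Extension

variable {X K : Type*} [MeasurableSpace X] [TopologicalSpace K] [MeasurableSpace K]
variable {μ : Measure X} {Ω : Set X} {Φ : X → X → ℝ → ℝ≥0∞} {φ : X → X → ℝ → ℝ} {ι : X → K}
variable {B : K → ℝ → ℝ≥0∞} {β : K → ℝ → ℝ} {ν : Measure K}
variable {u f : Lp ℝ 2 (μ.restrict Ω)} {w : X →ₘ[μ] ℝ}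

lemma coe_le_coe_sub_coe_iff {a b : ℝ≥0∞} (ha : a ≠ ⊤) (hb : b ≠ ⊤) (c : ℝ) :
    (c : EReal) ≤ (a : EReal) - (b : EReal) ↔ b.toReal + c ≤ a.toReal := by
  lift a to NNReal using ha
  lift b to NNReal using hb
  have ha : ((a : ℝ≥0∞) : EReal) = ((a : ℝ) : EReal) := rfl
  have hb : ((b : ℝ≥0∞) : EReal) = ((b : ℝ) : EReal) := rfl
  rw [ha, hb, ← EReal.coe_sub, EReal.coe_le_coe_iff]
  simp only [ENNReal.coe_toReal]
  constructor <;> intro h <;> linarith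

namespace EnergyData

/-- An elliptic extension of `u` has least energy among all extensions of `u`. -/
lemma energyB_le (H : EnergyData μ Ω Φ φ ι B β ν)
    (hw : IsEllipticExtension (W μ Ω Φ) (restr μ Ω) (energyB μ Ω Φ ι B ν) u f w)
    {v : X →ₘ[μ] ℝ} (hv : v ∈ W μ Ω Φ) (hvu : restr μ Ω v = u) :
    energyB μ Ω Φ ι B ν w ≤ energyB μ Ω Φ ι B ν v := by
  obtain ⟨hwW, hE, hu, hs⟩ := hw
  rcases eq_top_or_lt_top (energyB μ Ω Φ ι B ν v) with ht | ht
  · rw [ht]; exact le_top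
  · have h1 := hs (v - w) (sub_mem_W H.kernel H.kernel_delta2 hv hwW)
    rw [restr_sub hv hwW, hvu, hu, sub_self, inner_zero_right, add_sub_cancel,
      coe_le_coe_sub_coe_iff ht.ne hE.ne, add_zero] at h1
    exact (ENNReal.toReal_le_toReal hE.ne ht.ne).1 h1

lemma mem_argmin (H : EnergyData μ Ω Φ φ ι B β ν)
    (hw : IsEllipticExtension (W μ Ω Φ) (restr μ Ω) (energyB μ Ω Φ ι B ν) u f w) :
    w ∈ argmin (fun v => (energyB μ Ω Φ ι B ν v : EReal))
      {v | v ∈ W μ Ω Φ ∧ restr μ Ω v = u} :=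
  ⟨⟨hw.1, hw.2.2.1⟩, fun _ hv => EReal.coe_ennreal_le_coe_ennreal_iff.2 (H.energyB_le hw hv.1 hv.2)⟩

lemma setIntegral_mul_eq {v : X →ₘ[μ] ℝ} (f : Lp ℝ 2 (μ.restrict Ω)) (hv : v ∈ W μ Ω Φ) :
    ∫ x in Ω, f x * v x ∂μ = ∫ x in Ω, f x * restr μ Ω v x ∂μ := by
  rw [restr_eq_toLp hv.2]
  refine integral_congr_ae ?_
  filter_upwards [hv.2.coeFn_toLp] with x hx
  rw [hx]

lemma mem_argmin_sub (H : EnergyData μ Ω Φ φ ι B β ν)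
    (hw : IsEllipticExtension (W μ Ω Φ) (restr μ Ω) (energyB μ Ω Φ ι B ν) u f w) :
    w ∈ argmin (fun v => (energyB μ Ω Φ ι B ν v : EReal) - ((∫ x in Ω, f x * v x ∂μ : ℝ) : EReal))
      {v | v ∈ W μ Ω Φ ∧ restr μ Ω v = u} := by
  refine ⟨⟨hw.1, hw.2.2.1⟩, fun v hv => ?_⟩
  have h1 : ∫ x in Ω, f x * w x ∂μ = ∫ x in Ω, f x * v x ∂μ := by
    rw [setIntegral_mul_eq f hw.1, setIntegral_mul_eq f hv.1, hv.2, hw.2.2.1]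
  simp only [mem_ofPred_eq, h1]
  exact EReal.sub_le_sub (EReal.coe_ennreal_le_coe_ennreal_iff.2 (H.energyB_le hw hv.1 hv.2)) le_rfl

/-- If there is an elliptic extension `w₀` of `u`, every extension of `u` of least energy is
one: test the subgradient inequality of `w₀` with `w - w₀ + v`. -/
lemma isEllipticExtension_of_mem_argmin (H : EnergyData μ Ω Φ φ ι B β ν) {w₀ : X →ₘ[μ] ℝ}
    (hw₀ : IsEllipticExtension (W μ Ω Φ) (restr μ Ω) (energyB μ Ω Φ ι B ν) u f w₀)
    (hw : w ∈ argmin (fun v => (energyB μ Ω Φ ι B ν v : EReal))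
      {v | v ∈ W μ Ω Φ ∧ restr μ Ω v = u}) :
    IsEllipticExtension (W μ Ω Φ) (restr μ Ω) (energyB μ Ω Φ ι B ν) u f w := by
  obtain ⟨⟨hwW, hwu⟩, hmin⟩ := hw
  have hle : energyB μ Ω Φ ι B ν w ≤ energyB μ Ω Φ ι B ν w₀ :=
    EReal.coe_ennreal_le_coe_ennreal_iff.1 (hmin ⟨hw₀.1, hw₀.2.2.1⟩)
  have heq : energyB μ Ω Φ ι B ν w = energyB μ Ω Φ ι B ν w₀ :=
    le_antisymm hle (H.energyB_le hw₀ hwW hwu)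
  refine ⟨hwW, heq ▸ hw₀.2.1, hwu, fun v hv => ?_⟩
  have hd := sub_mem_W H.kernel H.kernel_delta2 hwW hw₀.1
  have h1 := hw₀.2.2.2 (w - w₀ + v) (add_mem_W H.kernel H.kernel_delta2 hd hv)
  rwa [restr_add hd hv, restr_sub hwW hw₀.1, hwu, hw₀.2.2.1, sub_self, zero_add, ← add_assoc,
    add_sub_cancel, ← heq] at h1

variable [BorelSpace K]

/-- Elliptic extensions are the solutions of the variational equation `a(ŵ, ·) = ⟨f, j ·⟩`. -/
lemma isEllipticExtension_iff (H : EnergyData μ Ω Φ φ ι B β ν) :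
    IsEllipticExtension (W μ Ω Φ) (restr μ Ω) (energyB μ Ω Φ ι B ν) u f w ↔
      w ∈ WB μ Ω Φ ι B ν ∧ restr μ Ω w = u ∧
        ∀ v ∈ WB μ Ω Φ ι B ν, form Ω Φ ι φ β ν w v = inner ℝ f (restr μ Ω v) := by
  constructor
  · rintro ⟨hw, hE, hu, hs⟩
    have hwB := H.mem_WB_of_energyB_lt_top hw hE
    refine ⟨hwB, hu, fun v hv => H.form_eq_of_support hwB hv fun t => ?_⟩
    have h1 := hs (t • v) (H.smul_mem_WB t hv).1
    rw [coe_le_coe_sub_coe_iff (H.energyB_lt_top (H.add_mem_WB hwB (H.smul_mem_WB t hv))).ne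
      hE.ne, restr_smul t hv.1, inner_smul_right] at h1
    exact h1
  · rintro ⟨hw, hu, hs⟩
    have hE := H.energyB_lt_top hw
    refine ⟨hw.1, hE, hu, fun v hv => ?_⟩
    rcases eq_top_or_lt_top (energyB μ Ω Φ ι B ν (w + v)) with ht | ht
    · lift energyB μ Ω Φ ι B ν w to NNReal using hE.ne with r
      rw [ht]
      exact le_of_le_of_eq le_top (EReal.top_sub_coe (r : ℝ)).symm
    · have hwv := H.mem_WB_of_energyB_lt_top (add_mem_W H.kernel H.kernel_delta2 hw.1 hv) ht
      have hvB : v ∈ WB μ Ω Φ ι B ν := by simpa using H.sub_mem_WB hwv hw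
      rw [coe_le_coe_sub_coe_iff ht.ne hE.ne, ← hs v hvB]
      exact H.toReal_energyB_add_form_le hw hvB

/-- Since the test functions separate the points of their associate space, the value of the
operator in the Robin identity is `f`, extended by zero. -/
lemma isRobinSolution_iff (H : EnergyData μ Ω Φ φ ι B β ν) (hΩ : MeasurableSet Ω)
    {D : Submodule ℝ (X →ₘ[μ] ℝ)} (hD : ∀ v ∈ D, v ∈ WB μ Ω Φ ι B ν)
    (hsep : SeparatesAssociate D) :
    IsRobinSolution Ω Φ ι φ B β ν D u f w ↔
      IsEllipticExtension (W μ Ω Φ) (restr μ Ω) (energyB μ Ω Φ ι B ν) u f w := by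
  rw [H.isEllipticExtension_iff]
  constructor
  · rintro ⟨hw, hu, ⟨-, hf, hfD⟩, g, ⟨-, hg, hgD⟩, hgW⟩
    refine ⟨hw, hu, fun v hv => ?_⟩
    have hzero : (fun x => g x - Ω.indicator f x) =ᵐ[μ] 0 := by
      refine hsep _ ⟨hg.1.sub hf.1, fun v hv => ?_⟩ fun v hv => ?_
      · simp only [sub_mul]
        exact (hg.2 v hv).sub (hf.2 v hv)
      · simp only [sub_mul]
        rw [integral_sub (hg.2 v hv) (hf.2 v hv), ← hgD v hv, ← hfD v hv, sub_self]
    rw [inner_restr hΩ f hv.1.2, (hgW v hv).2]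
    refine integral_congr_ae ?_
    filter_upwards [hzero] with x hx
    rw [sub_eq_zero.1 hx]
  · rintro ⟨hw, hu, hs⟩
    have hint : ∀ v ∈ WB μ Ω Φ ι B ν, Integrable (fun x => Ω.indicator f x * v x) μ ∧
        form Ω Φ ι φ β ν w v = ∫ x, Ω.indicator f x * v x ∂μ := fun v hv =>
      ⟨integrable_indicator_mul hΩ f hv.1.2, by rw [hs v hv, inner_restr hΩ f hv.1.2]⟩
    have hweak : IsWeakSolution Ω Φ ι φ B β ν D w (Ω.indicator f) :=
      ⟨hw, ⟨(aestronglyMeasurable_indicator_iff hΩ).2 (Lp.aestronglyMeasurable f),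
        fun v hv => (hint v (hD v hv)).1⟩, fun v hv => (hint v (hD v hv)).2⟩
    exact ⟨hw, hu, hweak, Ω.indicator f, hweak, hint⟩

/-- Two elliptic extensions have the same increments almost everywhere on `S_Φ`, if the kernel is
strictly convex there: otherwise their mean would have smaller energy. -/
lemma incr_ae_eq (H : EnergyData μ Ω Φ φ ι B β ν)
    (hstrict : ∀ x y, (x, y) ∈ supp Φ → StrictConvexFn (Φ x y)) {w₁ w₂ : X →ₘ[μ] ℝ}
    (h₁ : IsEllipticExtension (W μ Ω Φ) (restr μ Ω) (energyB μ Ω Φ ι B ν) u f w₁)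
    (h₂ : IsEllipticExtension (W μ Ω Φ) (restr μ Ω) (energyB μ Ω Φ ι B ν) u f w₂) :
    ∀ᵐ p ∂μ.prod μ, p ∈ supp Φ → incr w₁ p = incr w₂ p := by
  have hB₁ := H.mem_WB_of_energyB_lt_top h₁.1 h₁.2.1
  have hB₂ := H.mem_WB_of_energyB_lt_top h₂.1 h₂.2.1
  have hs₁ := H.smul_mem_WB (2⁻¹ : ℝ) hB₁
  have hs₂ := H.smul_mem_WB (2⁻¹ : ℝ) hB₂
  have hw := H.add_mem_WB hs₁ hs₂
  set w : X →ₘ[μ] ℝ := (2⁻¹ : ℝ) • w₁ + (2⁻¹ : ℝ) • w₂ with hw_def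
  have hwu : restr μ Ω w = u := by
    rw [hw_def, restr_add hs₁.1 hs₂.1, restr_smul _ h₁.1, restr_smul _ h₂.1, h₁.2.2.1, h₂.2.2.1,
      ← add_smul]
    norm_num
  have e₁ := ENNReal.toReal_mono (H.energyB_lt_top hw).ne (H.energyB_le h₁ hw.1 hwu)
  have e₂ := ENNReal.toReal_mono (H.energyB_lt_top hw).ne (H.energyB_le h₂ hw.1 hwu)
  have hincr : incr w =ᵐ[μ.prod μ] fun p => 2⁻¹ * incr w₁ p + 2⁻¹ * incr w₂ p := by
    filter_upwards [incr_add ((2⁻¹ : ℝ) • w₁) ((2⁻¹ : ℝ) • w₂), incr_smul (2⁻¹ : ℝ) w₁,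
      incr_smul (2⁻¹ : ℝ) w₂] with p hp hp₁ hp₂
    rw [hw_def, hp, hp₁, hp₂]
  have hqc : qcRep μ Ω Φ ι w =ᵐ[ν]
      fun x => 2⁻¹ * qcRep μ Ω Φ ι w₁ x + 2⁻¹ * qcRep μ Ω Φ ι w₂ x := by
    filter_upwards [H.qcRep_add hs₁ hs₂, H.qcRep_smul (2⁻¹ : ℝ) hB₁,
      H.qcRep_smul (2⁻¹ : ℝ) hB₂] with p hp hp₁ hp₂
    rw [hw_def, hp, hp₁, hp₂]
  have hΦw : ∫⁻ p : X × X, Φ p.1 p.2 (incr w p) ∂μ.prod μ =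
      ∫⁻ p : X × X, Φ p.1 p.2 (2⁻¹ * incr w₁ p + 2⁻¹ * incr w₂ p) ∂μ.prod μ :=
    lintegral_congr_ae (hincr.mono fun p hp => by simp only [hp])
  have hBw : ∫⁻ x, B x (qcRep μ Ω Φ ι w x) ∂ν =
      ∫⁻ x, B x (2⁻¹ * qcRep μ Ω Φ ι w₁ x + 2⁻¹ * qcRep μ Ω Φ ι w₂ x) ∂ν :=
    lintegral_congr_ae (hqc.mono fun p hp => by simp only [hp])
  rw [H.toReal_energyB hw, H.toReal_energyB hB₁, hΦw, hBw] at e₁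
  rw [H.toReal_energyB hw, H.toReal_energyB hB₂, hΦw, hBw] at e₂
  have hBle := (H.finMod_qcRep hB₁).toReal_lintegral_half_add_le (H.finMod_qcRep hB₂)
    H.potential H.potential_delta2
  have hae := (H.finMod_incr hB₁).ae_eq_of_le_toReal_lintegral_half_add (H.finMod_incr hB₂)
    H.kernel H.kernel_delta2 (by linarith)
  filter_upwards [hae] with p hp hpS
  by_contra hne
  have n₁ : 2⁻¹ * Φ p.1 p.2 (incr w₁ p) ≠ ⊤ :=
    ENNReal.mul_ne_top (by simp) (H.kernel.ne_top p _)
  have n₂ : 2⁻¹ * Φ p.1 p.2 (incr w₂ p) ≠ ⊤ :=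
    ENNReal.mul_ne_top (by simp) (H.kernel.ne_top p _)
  have hlt := hstrict p.1 p.2 hpS (incr w₁ p) (incr w₂ p) 2⁻¹ 2⁻¹ hne (H.kernel.ne_top p _)
    (H.kernel.ne_top p _) (by norm_num) (by norm_num) (by norm_num)
  rw [ENNReal.ofReal_inv_of_pos two_pos, ENNReal.ofReal_ofNat,
    ← ENNReal.toReal_lt_toReal (H.kernel.ne_top p _) (ENNReal.add_ne_top.2 ⟨n₁, n₂⟩),
    ENNReal.toReal_add n₁ n₂, ENNReal.toReal_mul, ENNReal.toReal_mul, hp] at hlt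
  simp at hlt

lemma eq_of_isEllipticExtension [SFinite μ] (H : EnergyData μ Ω Φ φ ι B β ν)
    (hΩ : MeasurableSet Ω) (hthick : Thick μ Ω (supp Φ))
    (hstrict : ∀ x y, (x, y) ∈ supp Φ → StrictConvexFn (Φ x y)) {w₁ w₂ : X →ₘ[μ] ℝ}
    (h₁ : IsEllipticExtension (W μ Ω Φ) (restr μ Ω) (energyB μ Ω Φ ι B ν) u f w₁)
    (h₂ : IsEllipticExtension (W μ Ω Φ) (restr μ Ω) (energyB μ Ω Φ ι B ν) u f w₂) :
    w₁ = w₂ := by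
  have hrestr : w₁ =ᵐ[μ.restrict Ω] w₂ := by
    have h := h₁.2.2.1.trans h₂.2.2.1.symm
    rw [restr_eq_toLp h₁.1.2, restr_eq_toLp h₂.1.2] at h
    exact (MemLp.toLp_eq_toLp_iff _ _).1 h
  refine AEEqFun.ext ?_
  have h0 := hthick.ae_eq_zero (v := fun x => w₁ x - w₂ x)
    ((ae_restrict_iff' hΩ).1 (hrestr.mono fun x hx => sub_eq_zero.2 hx))
    ((H.incr_ae_eq hstrict h₁ h₂).mono fun p hp hpS => by
      have := hp hpS
      simp only [incr] at this
      linarith)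
  exact h0.mono fun x hx => sub_eq_zero.1 hx

end EnergyData

end Extension

end NonlocalRobin

theorem theorem6p4 {X K : Type*}
    [TopologicalSpace X] [T2Space X] [MeasurableSpace X] [BorelSpace X]
    [TopologicalSpace K] [CompactSpace K] [MeasurableSpace K] [BorelSpace K]
    (μ : Measure X) [SigmaFinite μ] [μ.IsOpenPosMeasure]
    (Ω : Set X) (hΩ : MeasurableSet Ω)
    (Φ : X → X → ℝ → ℝ≥0∞) (hΦ : NonlocalRobin.StandardCond μ Ω Φ)
    (ι : X → K) (hι : IsDenseEmbedding ι)
    (hreg : NonlocalRobin.IsRegularEnergy μ Ω Φ ι)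
    (B : K → ℝ → ℝ≥0∞) (hB : NonlocalRobin.PotentialCond B)
    (ν : Measure K) (hν : NonlocalRobin.CapAbsCont μ Ω Φ ι ν)
    (hBΔ : NonlocalRobin.Delta2 ν B) (hBΔconj : NonlocalRobin.Delta2 ν (NonlocalRobin.conj B))
    (φ : X → X → ℝ → ℝ) (hφ : NonlocalRobin.KernelDeriv Φ φ)
    (β : K → ℝ → ℝ) (hβ : NonlocalRobin.PotentialDeriv B β)
    (D : Submodule ℝ (X →ₘ[μ] ℝ)) (hD : ∀ v ∈ D, v ∈ NonlocalRobin.WB μ Ω Φ ι B ν)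
    (hsep : NonlocalRobin.SeparatesAssociate D)
    (u f : Lp ℝ 2 (μ.restrict Ω)) :
    -- characterization of the `j`-subgradient
    ((u, f) ∈ NonlocalRobin.jSubgradient (NonlocalRobin.W μ Ω Φ) (NonlocalRobin.restr μ Ω)
          (NonlocalRobin.energyB μ Ω Φ ι B ν) ↔
        ∃ w, NonlocalRobin.IsRobinSolution Ω Φ ι φ B β ν D u f w) ∧
    -- these functions are exactly the elliptic extensions
    (∀ w, NonlocalRobin.IsRobinSolution Ω Φ ι φ B β ν D u f w ↔
        NonlocalRobin.IsEllipticExtension (NonlocalRobin.W μ Ω Φ) (NonlocalRobin.restr μ Ω)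
          (NonlocalRobin.energyB μ Ω Φ ι B ν) u f w) ∧
    -- and they minimize the two functionals among all extensions of `u`
    (∀ w, NonlocalRobin.IsRobinSolution Ω Φ ι φ B β ν D u f w →
        w ∈ NonlocalRobin.argmin
            (fun v => (NonlocalRobin.energyB μ Ω Φ ι B ν v : EReal) -
              ((∫ x in Ω, f x * v x ∂μ : ℝ) : EReal))
            {v | v ∈ NonlocalRobin.W μ Ω Φ ∧ NonlocalRobin.restr μ Ω v = u} ∧
        w ∈ NonlocalRobin.argmin
            (fun v => (NonlocalRobin.energyB μ Ω Φ ι B ν v : EReal))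
            {v | v ∈ NonlocalRobin.W μ Ω Φ ∧ NonlocalRobin.restr μ Ω v = u}) ∧
    -- and, as soon as there is one, all minimizers are obtained
    ((u, f) ∈ NonlocalRobin.jSubgradient (NonlocalRobin.W μ Ω Φ) (NonlocalRobin.restr μ Ω)
          (NonlocalRobin.energyB μ Ω Φ ι B ν) →
        ∀ w ∈ NonlocalRobin.argmin
            (fun v => (NonlocalRobin.energyB μ Ω Φ ι B ν v : EReal))
            {v | v ∈ NonlocalRobin.W μ Ω Φ ∧ NonlocalRobin.restr μ Ω v = u},
          NonlocalRobin.IsRobinSolution Ω Φ ι φ B β ν D u f w) ∧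
    -- uniqueness in the strictly convex case
    ((∀ x y, (x, y) ∈ NonlocalRobin.supp Φ → NonlocalRobin.StrictConvexFn (Φ x y)) →
        ∀ w₁ w₂,
          NonlocalRobin.IsEllipticExtension (NonlocalRobin.W μ Ω Φ) (NonlocalRobin.restr μ Ω)
            (NonlocalRobin.energyB μ Ω Φ ι B ν) u f w₁ →
          NonlocalRobin.IsEllipticExtension (NonlocalRobin.W μ Ω Φ) (NonlocalRobin.restr μ Ω)
            (NonlocalRobin.energyB μ Ω Φ ι B ν) u f w₂ →
          w₁ = w₂) := by
  have H : NonlocalRobin.EnergyData μ Ω Φ φ ι B β ν :=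
    ⟨hφ.smoothIntegrand hΦ.kernel, hΦ.delta2, hβ.smoothIntegrand hB, hBΔ, hν⟩
  have hiff : ∀ w, NonlocalRobin.IsRobinSolution Ω Φ ι φ B β ν D u f w ↔
      NonlocalRobin.IsEllipticExtension (NonlocalRobin.W μ Ω Φ) (NonlocalRobin.restr μ Ω)
        (NonlocalRobin.energyB μ Ω Φ ι B ν) u f w :=
    fun _ => H.isRobinSolution_iff hΩ hD hsep
  refine ⟨(exists_congr hiff).symm, hiff, fun w hw => ?_, ?_, fun hstrict w₁ w₂ h₁ h₂ =>
    H.eq_of_isEllipticExtension hΩ hΦ.thick hstrict h₁ h₂⟩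
  · exact ⟨H.mem_argmin_sub ((hiff w).1 hw), H.mem_argmin ((hiff w).1 hw)⟩
  · rintro ⟨w₀, hw₀⟩ w hw
    exact (hiff w).2 (H.isEllipticExtension_of_mem_argmin hw₀ hw)
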